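/- Let $\mathbf K$ be an abstract elementary class (AEC) in a finitary vocabulary, with Löwenheim–Skolem–Tarski number $\mathrm{LS}(\mathbf K)$, and let $\mu>\mathrm{LS}(\mathbf K)$ be a strong limit cardinal of countable cofinality. For a set $\Theta$ of cardinals, $\mathbf K_\Theta$ is the class of models in $\mathbf K$ of cardinality in $\Theta$; $\mathbf S(M)$ is the set of (Galois) types over $M$ of elements of $\mathbf K$-extensions of $M$. Assume: 1. $\mathbf K_\mu$ has weak amalgamation: if $M\le N_1,N_2$ in $\mathbf K_\mu$, $a_\ell\in N_\ell$ and $\mathbf{tp}(a_1/M;N_1)=\mathbf{tp}(a_2/M;N_2)$, then there are $N_1^0,N_2'\in\mathbf K_\mu$ with $M\le N_1^0\le N_1$, $a_1\in N_1^0$, $N_2\le N_2'$, and a $\mathbf K$-embedding $f:N_1^0\to N_2'$ fixing $M$ pointwise with $f(a_1)=a_2$. 2. $\mathbf K_{<\mu}$ has coherent sequences: whenever $\langle M_i:i<\alpha\rangle$ is an increasing continuous chain in $\mathbf K_{<\mu}$ and $\langle p_i\in\mathbf S(M_i):i<\alpha\rangle$ is an increasing chain of types that is local (for every limit $i<\alpha$,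 $p_i$ is the only $q\in\mathbf S(M_i)$ with $q\restriction M_j=p_j$ for all $j<i$), there are an increasing continuous chain $\langle N_i:i<\alpha\rangle$ in $\mathbf K_{<\mu}$ with $M_i\le N_i$, elements $a_i\in N_i$ with $p_i=\mathbf{tp}(a_i/M_i;N_i)$, and $\mathbf K$-embeddings $f_{ij}:N_i\to N_j$ ($i\le j<\alpha$) fixing $M_i$ pointwise, with $f_{ii}=\mathrm{id}$, $f_{jk}f_{ij}=f_{ik}$ and $f_{ij}(a_i)=a_j$. 3. $\mathbf K_{\le\mu}$ is $\mathrm{LS}(\mathbf K)$-tame: distinct $p,q\in\mathbf S(M)$, $M\in\mathbf K_{\le\mu}$, have distinct restrictions to some $A\subseteq M$ with $|A|\le\mathrm{LS}(\mathbf K)$. 4. For every infinite cardinal $\theta<\mu$ there is an infinite cardinal $\lambda<\mu$ with $\lambda=\lambda^\theta$ such that $\mathbf K$ is categorical in $\lambda$ (has exactly one model of cardinality $\lambda$ up to isomorphism). Let $M\in\mathbf K_\mu$ be non-maximal, i.e. some $N\in\mathbf K$ satisfies $M<_{\mathbf K}N$, and let $\mathbf K_M$ be the AEC of models of $\mathbf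 K$ above $M$, in the vocabulary with constant symbols for the elements of $M$. Then there is a type-full good$^{-S}$ $\mu$-frame on $\mathbf K_M$ whose nonforking is given by nonsplitting over small submodels. Explicitly, the basic types are all nonalgebraic types over models in $(\mathbf K_M)_\mu$, and for $N_0\le N_1\le N$ in $(\mathbf K_M)_\mu$ and $a\in N$, the quadruple $(N_0,N_1,a,N)$ is nonforking if and only if $a\notin N_1$ and there is $N'\le_{\mathbf K}N_0$ with $\mathrm{LS}(\mathbf K)\le\|N'\|<\mu$ such that $\mathbf{tp}_{\mathbf K}(a/N_1;N)$ does not split over $N'$. Here $p\in\mathbf S(N_1)$ splits over $A\subseteq N_1$ if there are $M_1,M_2\le_{\mathbf K}N_1$ of cardinality at most $|A|+\aleph_0$, both containing $A$, and an isomorphism $f:M_1\cong M_2$ fixing $A$ pointwise such that $f(p\restriction M_1)\ne p\restriction M_2$. A good$^{-S}$ $\mu$-frame on an AEC $\mathbf K'$ consists of sets of basic (nonalgebraic) types over models in $\mathbf K'_\mu$ and a nonforking relation on quadruples $(N_0,N_1,a,N)$ ($N_0\le N_1\le N$ in $\mathbf K'_\mu$, $a\in N$) satisfying all axioms of a good $\mu$-frame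 except possibly symmetry: $\mathrm{LS}(\mathbf K')\le\mu$; $\mathbf K'_\mu$ is nonempty and has amalgamation, joint embedding and no maximal models; there are at most $\mu$ basic types over each $N\in\mathbf K'_\mu$; if $N_0<N_1$ in $\mathbf K'_\mu$ then some $a\in N_1$ has basic type over $N_0$; basic types and nonforking are invariant under isomorphism; nonforking is monotone; nonforking types are basic; and nonforking satisfies existence of nonforking basic extensions, uniqueness, local character and continuity along increasing continuous chains of limit length, and transitivity. -/

import Mathlib

open FirstOrder FirstOrder.Language CategoryTheory

universe u

/-! ## Abstract classes and abstract elementary classes -/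

/-- An abstract class `(K, ≤_K)` of `L`-structures, presented through its `K`-embeddings.
`Mem M` says `M ∈ K`; `IsEmb f` says that the embedding of structures `f : M → N` is a
`K`-embedding, i.e. that `M, N ∈ K` and `f[M] ≤_K N`.  In particular `M ≤_K N` holds for a
substructure `M` of `N` iff the inclusion is a `K`-embedding (see `AbstractClass.Sub` and
`AbstractClass.isEmb_iff_sub_range`).  The axiom `isEmb_equiv` gives reflexivity of `≤_K` and
closure of `K` under isomorphism; with `isEmb_comp` it gives transitivity and
invariance of `≤_K` under isomorphism. -/
structure AbstractClass (L : FirstOrder.Language.{u, u}) where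
  Mem : Bundled.{u} L.Structure → Prop
  IsEmb : ∀ {M N : Bundled.{u} L.Structure}, (M ↪[L] N) → Prop
  mem_dom : ∀ {M N : Bundled.{u} L.Structure} {f : M ↪[L] N}, IsEmb f → Mem M
  mem_cod : ∀ {M N : Bundled.{u} L.Structure} {f : M ↪[L] N}, IsEmb f → Mem N
  isEmb_equiv : ∀ {M N : Bundled.{u} L.Structure} (e : M ≃[L] N), Mem M → IsEmb e.toEmbedding
  isEmb_comp : ∀ {M N P : Bundled.{u} L.Structure} {f : M ↪[L] N} {g : N ↪[L] P},
    IsEmb f → IsEmb g → IsEmb (g.comp f)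

namespace AbstractClass

variable {L : FirstOrder.Language.{u, u}}

/-- `S ≤_K N` for a substructure `S` of `N`. -/
def Sub (K : AbstractClass L) (N : Bundled.{u} L.Structure) (S : L.Substructure N) : Prop :=
  K.IsEmb (M := ⟨S, inferInstance⟩) (N := N) S.subtype

/-- A `K`-embedding `f : M → N` is exactly an isomorphism from `M ∈ K` onto a substructure
`f[M] ≤_K N`. -/
theorem isEmb_iff_sub_range (K : AbstractClass L) {M N : Bundled.{u} L.Structure}
    (f : M ↪[L] N) : K.IsEmb f ↔ K.Mem M ∧ K.Sub N f.toHom.range := by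
  let R : Bundled.{u} L.Structure := ⟨f.toHom.range, inferInstance⟩
  let e : M ≃[L] R := f.equivRange
  have he : ∀ x : M, (f.toHom.range.subtype) (e x) = f x := fun x => rfl
  constructor
  · intro h
    refine ⟨K.mem_dom h, ?_⟩
    have hR : K.Mem R := K.mem_cod (K.isEmb_equiv e (K.mem_dom h))
    have h2 := K.isEmb_comp (K.isEmb_equiv e.symm hR) h
    have : f.comp e.symm.toEmbedding = (f.toHom.range.subtype : R ↪[L] N) := by
      ext x
      obtain ⟨y, rfl⟩ := e.surjective x
      have h3 : e.symm.toEmbedding (e y) = y := e.symm_apply_apply y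
      rw [Embedding.comp_apply, h3, he]
    rw [this] at h2
    exact h2
  · rintro ⟨hM, h⟩
    have h' : K.IsEmb (M := R) (N := N) f.toHom.range.subtype := h
    have h2 := K.isEmb_comp (K.isEmb_equiv e hM) h'
    have : (f.toHom.range.subtype : R ↪[L] N).comp e.toEmbedding = f := by
      ext x
      exact he x
    rwa [this] at h2

/-- The restriction of `K` to the models whose cardinality lies in `Θ`. -/
def restrict (K : AbstractClass L) (Θ : Set Cardinal.{u}) : AbstractClass L where
  Mem M := K.Mem M ∧ Cardinal.mk M ∈ Θ
  IsEmb {M N} f := K.IsEmb f ∧ Cardinal.mk M ∈ Θ ∧ Cardinal.mk N ∈ Θ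
  mem_dom h := ⟨K.mem_dom h.1, h.2.1⟩
  mem_cod h := ⟨K.mem_cod h.1, h.2.2⟩
  isEmb_equiv e h := ⟨K.isEmb_equiv e h.1, h.2, by
    rw [← Cardinal.mk_congr e.toEquiv]; exact h.2⟩
  isEmb_comp hf hg := ⟨K.isEmb_comp hf.1 hg.1, hf.2.1, hg.2.2⟩

/-- A `≤_K`-increasing system of models indexed by `I`: the maps `map` play the role of the
inclusions `M_i ≤_K M_j`. A well-ordered index type gives an increasing chain
`⟨M_i : i < α⟩`, where `α` is the order type of `I`. -/
structure System (K : AbstractClass L) (I : Type u) [Preorder I] where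
  obj : I → Bundled.{u} L.Structure
  map : ∀ {i j : I}, i ≤ j → (obj i ↪[L] obj j)
  isEmb : ∀ {i j : I} (h : i ≤ j), K.IsEmb (map h)
  map_refl : ∀ (i : I) (x : obj i), map (le_refl i) x = x
  map_map : ∀ {i j k : I} (hij : i ≤ j) (hjk : j ≤ k) (x : obj i),
    map hjk (map hij x) = map (hij.trans hjk) x

/-- `M_i = ⋃_{j < i} M_j` at every limit `i`. -/
def System.IsContinuous {K : AbstractClass L} {I : Type u} [LinearOrder I]
    (D : K.System I) : Prop :=
  ∀ i : I, Order.IsSuccLimit i → ∀ x : D.obj i, ∃ (j : I) (h : j < i) (y : D.obj j),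
    D.map h.le y = x

/-- `M`, with the maps `g i` as inclusions, is the union `⋃_i M_i` of the system. -/
def System.IsUnion {K : AbstractClass L} {I : Type u} [Preorder I] (D : K.System I)
    (M : Bundled.{u} L.Structure) (g : ∀ i, D.obj i ↪[L] M) : Prop :=
  (∀ (i j : I) (h : i ≤ j) (x : D.obj i), g j (D.map h x) = g i x) ∧
  ∀ x : M, ∃ (i : I) (y : D.obj i), g i y = x

/-- `κ` satisfies the Löwenheim–Skolem–Tarski axiom. -/
def IsLSNumber (K : AbstractClass L) (κ : Cardinal.{u}) : Prop :=
  L.card + Cardinal.aleph0 ≤ κ ∧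
  ∀ N : Bundled.{u} L.Structure, K.Mem N → ∀ A : Set N,
    ∃ (M : Bundled.{u} L.Structure) (f : M ↪[L] N), K.IsEmb f ∧ A ⊆ Set.range f ∧
      Cardinal.mk M ≤ Cardinal.mk A + κ

/-- The Löwenheim–Skolem–Tarski number. -/
noncomputable def LS (K : AbstractClass L) : Cardinal.{u} := sInf {κ | K.IsLSNumber κ}

/-- Abstract elementary classes. -/
structure IsAEC (K : AbstractClass L) : Prop where
  /-- If `M₀ ⊆ M₁ ≤_K M₂` and `M₀ ≤_K M₂`, then `M₀ ≤_K M₁`. -/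
  coherence : ∀ {M₀ M₁ M₂ : Bundled.{u} L.Structure} (f : M₀ ↪[L] M₁) (g : M₁ ↪[L] M₂),
    K.Mem M₁ → K.IsEmb g → K.IsEmb (g.comp f) → K.IsEmb f
  /-- Tarski–Vaught: the union of a directed system is a member of `K` and is
  `≤_K`-above every member of the system. -/
  union : ∀ (I : Type u) [Preorder I] [IsDirectedOrder I] [Nonempty I] (D : K.System I)
    (M : Bundled.{u} L.Structure) (g : ∀ i, D.obj i ↪[L] M), D.IsUnion M g →
    K.Mem M ∧ ∀ i, K.IsEmb (g i)
  /-- Tarski–Vaught: if every member of the system is `≤_K N`, then so is the union. -/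
  union_le : ∀ (I : Type u) [Preorder I] [IsDirectedOrder I] [Nonempty I] (D : K.System I)
    (M : Bundled.{u} L.Structure) (g : ∀ i, D.obj i ↪[L] M), D.IsUnion M g →
    ∀ (N : Bundled.{u} L.Structure) (h : M ↪[L] N), K.Mem N →
      (∀ i, K.IsEmb (h.comp (g i))) → K.IsEmb h
  lowenheimSkolemTarski : ∃ κ, K.IsLSNumber κ

/-- Categoricity of an abstract class: exactly one model up to isomorphism. -/
def Categorical (K : AbstractClass L) : Prop :=
  (∃ M, K.Mem M) ∧
  ∀ M N : Bundled.{u} L.Structure, K.Mem M → K.Mem N → Nonempty (M ≃[L] N)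

def Amalgamation (K : AbstractClass L) : Prop :=
  ∀ {M₀ M₁ M₂ : Bundled.{u} L.Structure} (f₁ : M₀ ↪[L] M₁) (f₂ : M₀ ↪[L] M₂),
    K.IsEmb f₁ → K.IsEmb f₂ →
    ∃ (M₃ : Bundled.{u} L.Structure) (g₁ : M₁ ↪[L] M₃) (g₂ : M₂ ↪[L] M₃),
      K.IsEmb g₁ ∧ K.IsEmb g₂ ∧ ∀ x : M₀, g₁ (f₁ x) = g₂ (f₂ x)

def JointEmbedding (K : AbstractClass L) : Prop :=
  ∀ M₁ M₂ : Bundled.{u} L.Structure, K.Mem M₁ → K.Mem M₂ →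
    ∃ (M₃ : Bundled.{u} L.Structure) (g₁ : M₁ ↪[L] M₃) (g₂ : M₂ ↪[L] M₃),
      K.IsEmb g₁ ∧ K.IsEmb g₂

/-- `M` is maximal: there is no `N` with `M <_K N`. -/
def IsMaximalModel (K : AbstractClass L) (M : Bundled.{u} L.Structure) : Prop :=
  K.Mem M ∧ ∀ (N : Bundled.{u} L.Structure) (f : M ↪[L] N), K.IsEmb f → Function.Surjective f

def NoMaximalModels (K : AbstractClass L) : Prop := ∀ M, ¬ K.IsMaximalModel M

/-! ## Types -/

/-- A triple `(b, A, N)` with `N ∈ K`, `A ⊆ N` (given by the injection `incl`) and `b ∈ N`. -/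
structure Triple (K : AbstractClass L) (A : Type u) where
  model : Bundled.{u} L.Structure
  mem : K.Mem model
  incl : A ↪ model
  elt : model

/-- Atomic equivalence of triples over the same set `A`. -/
def EAt (K : AbstractClass L) {A : Type u} (t₁ t₂ : K.Triple A) : Prop :=
  ∃ (N : Bundled.{u} L.Structure) (f : t₁.model ↪[L] N) (g : t₂.model ↪[L] N),
    K.IsEmb f ∧ K.IsEmb g ∧ (∀ a : A, f (t₁.incl a) = g (t₂.incl a)) ∧ f t₁.elt = g t₂.elt

/-- Types over the set `A`: classes of triples modulo the equivalence relation generated by `EAt`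
(which is reflexive and symmetric, so this is its transitive closure). -/
def GTp (K : AbstractClass L) (A : Type u) : Type (u + 1) := Quot (K.EAt (A := A))

/-- `tp(b / A; N)`. -/
def tp (K : AbstractClass L) {A : Type u} {N : Bundled.{u} L.Structure} (hN : K.Mem N)
    (i : A ↪ N) (b : N) : K.GTp A := Quot.mk _ ⟨N, hN, i, b⟩

/-- The restriction `p ↾ B`, for `B ⊆ A` given by an injection. If `g` is a bijection, this is
the image of `p` under `g⁻¹`. -/
def GTp.restrict {K : AbstractClass L} {A B : Type u} (p : K.GTp A) (g : B ↪ A) : K.GTp B :=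
  Quot.map (fun t : K.Triple A => (⟨t.model, t.mem, g.trans t.incl, t.elt⟩ : K.Triple B))
    (fun _ _ ⟨N, f, g', hf, hg, h, hb⟩ => ⟨N, f, g', hf, hg, fun b => h (g b), hb⟩) p

/-- `S(M) = {tp(b / M; N) : M ≤_K N, b ∈ N}`. -/
def S (K : AbstractClass L) (M : Bundled.{u} L.Structure) : Set (K.GTp M) :=
  {p | ∃ (N : Bundled.{u} L.Structure) (f : M ↪[L] N) (hf : K.IsEmb f) (b : N),
    p = K.tp (K.mem_cod hf) f.toEmbedding b}

/-- A type over `M` is algebraic if it is `tp(a / M; N)` with `a ∈ M`. -/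
def IsAlgebraic (K : AbstractClass L) (M : Bundled.{u} L.Structure) (p : K.GTp M) : Prop :=
  ∃ (N : Bundled.{u} L.Structure) (f : M ↪[L] N) (hf : K.IsEmb f) (a : M),
    p = K.tp (K.mem_cod hf) f.toEmbedding (f a)

/-- The nonalgebraic types over `M`. -/
def Sna (K : AbstractClass L) (M : Bundled.{u} L.Structure) : Set (K.GTp M) :=
  {p | p ∈ K.S M ∧ ¬ K.IsAlgebraic M p}

/-- `(<χ)`-tameness. -/
def TameBelow (K : AbstractClass L) (χ : Cardinal.{u}) : Prop :=
  ∀ M : Bundled.{u} L.Structure, K.Mem M → ∀ p ∈ K.S M, ∀ q ∈ K.S M, p ≠ q →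
    ∃ A : Set M, Cardinal.mk A < χ ∧
      p.restrict (Function.Embedding.subtype (· ∈ A)) ≠
        q.restrict (Function.Embedding.subtype (· ∈ A))

/-- `χ`-tameness, that is, `(<χ⁺)`-tameness. -/
def Tame (K : AbstractClass L) (χ : Cardinal.{u}) : Prop := K.TameBelow (Order.succ χ)

/-- Every model is a weak amalgamation base. -/
def WeakAmalgamation (K : AbstractClass L) : Prop :=
  ∀ {M N₁ N₂ : Bundled.{u} L.Structure} (i₁ : M ↪[L] N₁) (i₂ : M ↪[L] N₂)
    (h₁ : K.IsEmb i₁) (h₂ : K.IsEmb i₂) (a₁ : N₁) (a₂ : N₂),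
    K.tp (K.mem_cod h₁) i₁.toEmbedding a₁ = K.tp (K.mem_cod h₂) i₂.toEmbedding a₂ →
    ∃ (P₁ N₂' : Bundled.{u} L.Structure) (j : M ↪[L] P₁) (k : P₁ ↪[L] N₁)
      (l : N₂ ↪[L] N₂') (f : P₁ ↪[L] N₂') (c : P₁),
      K.IsEmb j ∧ K.IsEmb k ∧ K.IsEmb l ∧ K.IsEmb f ∧
      (∀ x : M, k (j x) = i₁ x) ∧ k c = a₁ ∧
      (∀ x : M, f (j x) = l (i₂ x)) ∧ f c = l a₂

/-- `⟨p_i⟩` is an increasing chain of types, with `p_i ∈ S(M_i)`. -/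
def IsTypeChain (K : AbstractClass L) {I : Type u} [LinearOrder I] (D : K.System I)
    (p : ∀ i, K.GTp (D.obj i)) : Prop :=
  (∀ i, p i ∈ K.S (D.obj i)) ∧
  ∀ (i j : I) (h : i ≤ j), (p j).restrict (D.map h).toEmbedding = p i

/-- Local chains of types. -/
def IsLocalTypeChain (K : AbstractClass L) {I : Type u} [LinearOrder I] (D : K.System I)
    (p : ∀ i, K.GTp (D.obj i)) : Prop :=
  ∀ i : I, Order.IsSuccLimit i → ∀ q ∈ K.S (D.obj i),
    (∀ (j : I) (h : j < i), q.restrict (D.map h.le).toEmbedding = p j) → q = p i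

/-- Coherent chains of types. Here `N` is the increasing continuous chain `⟨N_i⟩`, `e i` is the
inclusion `M_i ≤_K N_i`, and `f` is the commuting system of maps `f_{ij} : N_i → N_j` fixing
`M_i` and moving `a_i` to `a_j`. -/
def IsCoherentTypeChain (K : AbstractClass L) {I : Type u} [LinearOrder I] (D : K.System I)
    (p : ∀ i, K.GTp (D.obj i)) : Prop :=
  ∃ (N : K.System I) (e : ∀ i, D.obj i ↪[L] N.obj i) (he : ∀ i, K.IsEmb (e i))
    (a : ∀ i, N.obj i) (f : ∀ {i j : I}, i ≤ j → (N.obj i ↪[L] N.obj j)),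
    N.IsContinuous ∧
    (∀ (i j : I) (h : i ≤ j) (x : D.obj i), e j (D.map h x) = N.map h (e i x)) ∧
    (∀ i, p i = K.tp (K.mem_cod (he i)) (e i).toEmbedding (a i)) ∧
    (∀ (i j : I) (h : i ≤ j), K.IsEmb (f h)) ∧
    (∀ (i j : I) (h : i ≤ j) (x : D.obj i), f h (e i x) = e j (D.map h x)) ∧
    (∀ (i : I) (x : N.obj i), f (le_refl i) x = x) ∧
    (∀ (i j k : I) (hij : i ≤ j) (hjk : j ≤ k) (x : N.obj i),
      f hjk (f hij x) = f (hij.trans hjk) x) ∧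
    (∀ (i j : I) (h : i ≤ j), f h (a i) = a j)

/-- `K` has coherent sequences: over any increasing continuous chain of models, every
local increasing chain of types is coherent. -/
def HasCoherentSequences (K : AbstractClass L) : Prop :=
  ∀ (I : Type u) [LinearOrder I] [WellFoundedLT I] (D : K.System I), D.IsContinuous →
    ∀ p : (∀ i, K.GTp (D.obj i)), K.IsTypeChain D p → K.IsLocalTypeChain D p →
      K.IsCoherentTypeChain D p

/-! ## Splitting -/

/-- `p` `(<θ)`-splits over `A ⊆ N`: there are `M₁, M₂ ∈ K_{<θ}` with `A ⊆ M_ℓ ≤_K N` and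
`e : M₁ ≅_A M₂` such that `e(p ↾ M₁) ≠ p ↾ M₂`. -/
def SplitsBelow (K : AbstractClass L) (θ : Cardinal.{u}) {N : Bundled.{u} L.Structure}
    (p : K.GTp N) (A : Set N) : Prop :=
  ∃ (M₁ M₂ : Bundled.{u} L.Structure) (m₁ : M₁ ↪[L] N) (m₂ : M₂ ↪[L] N) (e : M₁ ≃[L] M₂),
    K.IsEmb m₁ ∧ K.IsEmb m₂ ∧ Cardinal.mk M₁ < θ ∧ Cardinal.mk M₂ < θ ∧
    A ⊆ Set.range m₁ ∧ A ⊆ Set.range m₂ ∧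
    (∀ x : M₁, m₁ x ∈ A → m₂ (e x) = m₁ x) ∧
    (p.restrict m₁.toEmbedding).restrict e.symm.toEmbedding.toEmbedding ≠
      p.restrict m₂.toEmbedding

/-- `p` splits over `A` if it `(|A| + ℵ₀)`-splits over `A`. -/
def Splits (K : AbstractClass L) {N : Bundled.{u} L.Structure} (p : K.GTp N) (A : Set N) : Prop :=
  K.SplitsBelow (Order.succ (Cardinal.mk A + Cardinal.aleph0)) p A

/-- For `f : M₀ → M₁` (the inclusion `M₀ ≤_K M₁`) and `p ∈ S(M₁)`: there is `M' ≤_K M₀` with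
`LS(K) ≤ ‖M'‖ < μ` such that `p` does not split over `M'`. -/
def NonsplittingOverSmall (K : AbstractClass L) (μ : Cardinal.{u})
    {M₀ M₁ : Bundled.{u} L.Structure} (f : M₀ ↪[L] M₁) (p : K.GTp M₁) : Prop :=
  ∃ (M' : Bundled.{u} L.Structure) (h : M' ↪[L] M₀), K.IsEmb h ∧ K.LS ≤ Cardinal.mk M' ∧
    Cardinal.mk M' < μ ∧ ¬ K.Splits p (Set.range (f.comp h))

/-! ## The class of models above a given model -/

/-- The reduct to `L` of a structure in the vocabulary with constants for `A`. -/
def red {A : Type u} (N : Bundled.{u} L[[A]].Structure) : Bundled.{u} L.Structure :=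
  ⟨N, (L.lhomWithConstants A).reduct N⟩

/-- An embedding in the vocabulary with constants, as an embedding of reducts. -/
def redEmb {A : Type u} {N N' : Bundled.{u} L[[A]].Structure} (f : N ↪[L[[A]]] N') :
    red N ↪[L] red N' where
  toEmbedding := f.toEmbedding
  map_fun' g x := f.map_fun' ((L.lhomWithConstants A).onFunction g) x
  map_rel' r x := f.map_rel' ((L.lhomWithConstants A).onRelation r) x

/-- The isomorphism of reducts induced by an isomorphism. -/
def redEquiv {A : Type u} {N N' : Bundled.{u} L[[A]].Structure} (f : N ≃[L[[A]]] N') :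
    red N ≃[L] red N' where
  toEquiv := f.toEquiv
  map_fun' g x := f.map_fun' ((L.lhomWithConstants A).onFunction g) x
  map_rel' r x := f.map_rel' ((L.lhomWithConstants A).onRelation r) x

/-- The interpretation in `N` of the constant symbol for `a`. -/
def constVal {A : Type u} (N : Bundled.{u} L[[A]].Structure) (a : A) : red N :=
  ((L.con a : L[[A]].Constants) : N)

/-- Membership in `K_M`: the reduct of `N` to `L` is in `K` and `m ↦ c_m^N` is a `K`-embedding
of `M` into it. -/
def AboveMem (K : AbstractClass L) (M : Bundled.{u} L.Structure)
    (N : Bundled.{u} L[[M]].Structure) : Prop :=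
  ∃ f : M ↪[L] red N, K.IsEmb f ∧ ∀ m : M, f m = constVal N m

theorem AboveMem.of_emb {K : AbstractClass L} {M : Bundled.{u} L.Structure}
    {N N' : Bundled.{u} L[[M]].Structure} (hN : K.AboveMem M N) (f : N ↪[L[[M]]] N')
    (hf : K.IsEmb (redEmb f)) : K.AboveMem M N' := by
  obtain ⟨g, hg, hc⟩ := hN
  refine ⟨(redEmb f).comp g, K.isEmb_comp hg hf, fun m => ?_⟩
  rw [Embedding.comp_apply, hc]
  exact HomClass.map_constants f (L.con m)

/-- The class `K_M`, in the vocabulary with constant symbols for the elements of `M`. -/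
def above (K : AbstractClass L) (M : Bundled.{u} L.Structure) : AbstractClass (L[[M]]) where
  Mem N := K.AboveMem M N
  IsEmb {N N'} f := K.AboveMem M N ∧ K.AboveMem M N' ∧ K.IsEmb (redEmb f)
  mem_dom h := h.1
  mem_cod h := h.2.1
  isEmb_equiv {N N'} e h := by
    have he : K.IsEmb (redEmb e.toEmbedding) := by
      obtain ⟨g, hg, -⟩ := h
      exact K.isEmb_equiv (redEquiv e) (K.mem_cod hg)
    exact ⟨h, h.of_emb _ he, he⟩
  isEmb_comp hf hg := ⟨hf.1, hg.2.1, K.isEmb_comp hf.2.2 hg.2.2⟩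

/-! ## Good frames -/

/-- A pre-`lam`-frame on `K`: basic types `bs M ⊆ S(M)` for `M ∈ K_lam`, and a nonforking
relation `nf f g a` on quadruples `(M₀, M₁, a, N)`, where `M₀ ≤_K M₁ ≤_K N` are in `K_lam` (the
inclusions being `f` and `g`) and `a ∈ N`. -/
structure PreFrame (K : AbstractClass L) (lam : Cardinal.{u}) where
  bs : ∀ M : Bundled.{u} L.Structure, Set (K.GTp M)
  nf : ∀ {M₀ M₁ N : Bundled.{u} L.Structure}, (M₀ ↪[L] M₁) → (M₁ ↪[L] N) → N → Prop
  isAEC : K.IsAEC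
  LS_le : K.LS ≤ lam
  nonempty : ∃ M, (K.restrict {lam}).Mem M
  bs_sub : ∀ {M : Bundled.{u} L.Structure} {p : K.GTp M}, p ∈ bs M →
    (K.restrict {lam}).Mem M ∧ p ∈ K.Sna M
  nf_dom : ∀ {M₀ M₁ N : Bundled.{u} L.Structure} {f : M₀ ↪[L] M₁} {g : M₁ ↪[L] N} {a : N},
    nf f g a → (K.restrict {lam}).IsEmb f ∧ (K.restrict {lam}).IsEmb g
  /-- Basic types are invariant under isomorphism. -/
  bs_invariance : ∀ {M M' : Bundled.{u} L.Structure} (e : M ≃[L] M') {p : K.GTp M}, p ∈ bs M →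
    p.restrict e.symm.toEmbedding.toEmbedding ∈ bs M'
  /-- Nonforking is invariant under isomorphism. -/
  nf_invariance : ∀ {M₀ M₁ N M₀' M₁' N' : Bundled.{u} L.Structure}
    {f : M₀ ↪[L] M₁} {g : M₁ ↪[L] N} {f' : M₀' ↪[L] M₁'} {g' : M₁' ↪[L] N'} {a : N}
    (e₀ : M₀ ≃[L] M₀') (e₁ : M₁ ≃[L] M₁') (e : N ≃[L] N'),
    (∀ x, f' (e₀ x) = e₁ (f x)) → (∀ x, g' (e₁ x) = e (g x)) → nf f g a → nf f' g' (e a)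
  /-- If `M₀ ≤ M₀' ≤ M₁' ≤ M₁ ≤ N' ≤ N ≤ N''` and `a ∈ N'`, then nonforking of
  `(M₀, M₁, a, N)` implies that of `(M₀', M₁', a, N')` and of `(M₀', M₁', a, N'')`. -/
  monotonicity : ∀ {M₀ M₀' M₁' M₁ N' N N'' : Bundled.{u} L.Structure}
    (r : M₀ ↪[L] M₀') (s : M₀' ↪[L] M₁') (t : M₁' ↪[L] M₁) (v : M₁ ↪[L] N')
    (w : N' ↪[L] N) (z : N ↪[L] N'') (a : N'),
    (K.restrict {lam}).IsEmb r → (K.restrict {lam}).IsEmb s → (K.restrict {lam}).IsEmb t →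
    (K.restrict {lam}).IsEmb v → (K.restrict {lam}).IsEmb w → (K.restrict {lam}).IsEmb z →
    nf (t.comp (s.comp r)) (w.comp v) (w a) →
    nf s (v.comp t) a ∧ nf s (z.comp (w.comp (v.comp t))) (z (w a))
  /-- Nonforking types are basic. -/
  nf_bs : ∀ {M N : Bundled.{u} L.Structure} (f : M ↪[L] M) (g : M ↪[L] N) (hg : K.IsEmb g)
    (a : N), (∀ x, f x = x) → nf f g a → K.tp (K.mem_cod hg) g.toEmbedding a ∈ bs M

namespace PreFrame

variable {K : AbstractClass L} {lam : Cardinal.{u}}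

/-- The type `p` over `M₁` does not fork over `M₀` (included in `M₁` through `f`). -/
def DoesNotFork (s : K.PreFrame lam) {M₀ M₁ : Bundled.{u} L.Structure} (f : M₀ ↪[L] M₁)
    (p : K.GTp M₁) : Prop :=
  ∃ (N : Bundled.{u} L.Structure) (g : M₁ ↪[L] N) (hg : K.IsEmb g) (a : N),
    p = K.tp (K.mem_cod hg) g.toEmbedding a ∧ s.nf f g a

/-- The basic types are all the nonalgebraic types. -/
def IsTypeFull (s : K.PreFrame lam) : Prop :=
  ∀ M : Bundled.{u} L.Structure, (K.restrict {lam}).Mem M → s.bs M = K.Sna M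

/-- The axioms of a good `lam`-frame, except symmetry. -/
structure IsGoodMinusS (s : K.PreFrame lam) : Prop where
  amalgamation : (K.restrict {lam}).Amalgamation
  jointEmbedding : (K.restrict {lam}).JointEmbedding
  noMaximalModels : (K.restrict {lam}).NoMaximalModels
  stability : ∀ M : Bundled.{u} L.Structure, (K.restrict {lam}).Mem M →
    Cardinal.mk (s.bs M) ≤ Cardinal.lift.{u + 1} lam
  density : ∀ {M N : Bundled.{u} L.Structure} (f : M ↪[L] N)
    (hf : (K.restrict {lam}).IsEmb f), ¬ Function.Surjective f →
    ∃ a : N, K.tp (K.mem_cod hf.1) f.toEmbedding a ∈ s.bs M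
  existence : ∀ {M N : Bundled.{u} L.Structure} (f : M ↪[L] N), (K.restrict {lam}).IsEmb f →
    ∀ p ∈ s.bs M, ∃ q ∈ s.bs N, q.restrict f.toEmbedding = p ∧ s.DoesNotFork f q
  uniqueness : ∀ {M N : Bundled.{u} L.Structure} (f : M ↪[L] N), (K.restrict {lam}).IsEmb f →
    ∀ p ∈ s.bs N, ∀ q ∈ s.bs N, s.DoesNotFork f p → s.DoesNotFork f q →
      p.restrict f.toEmbedding = q.restrict f.toEmbedding → p = q
  /-- A basic type over the union of an increasing continuous chain of limit length does not
  fork over some member of the chain. -/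
  localCharacter : ∀ (I : Type u) [LinearOrder I] [WellFoundedLT I] [Nonempty I] [NoMaxOrder I]
    (D : (K.restrict {lam}).System I) (M : Bundled.{u} L.Structure)
    (g : ∀ i, D.obj i ↪[L] M), D.IsContinuous → D.IsUnion M g → (K.restrict {lam}).Mem M →
    ∀ p ∈ s.bs M, ∃ i, s.DoesNotFork (g i) p
  /-- If `⟨M_i : i ≤ δ⟩` is increasing continuous, `δ` is a limit, and the restrictions of
  `p ∈ S(M_δ)` to the `M_i`, `i < δ`, are basic and do not fork over `M_0`, then `p` is
  basic and does not fork over `M_0`. -/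
  continuity : ∀ (I : Type u) [LinearOrder I] [WellFoundedLT I] [Nonempty I] [NoMaxOrder I]
    (D : (K.restrict {lam}).System I) (M : Bundled.{u} L.Structure)
    (g : ∀ i, D.obj i ↪[L] M), D.IsContinuous → D.IsUnion M g → (K.restrict {lam}).Mem M →
    ∀ (i₀ : I) (h₀ : ∀ i, i₀ ≤ i), ∀ p ∈ K.S M,
      (∀ i, p.restrict (g i).toEmbedding ∈ s.bs (D.obj i) ∧
        s.DoesNotFork (D.map (h₀ i)) (p.restrict (g i).toEmbedding)) →
      p ∈ s.bs M ∧ s.DoesNotFork (g i₀) p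
  transitivity : ∀ {M₀ M₁ M₂ : Bundled.{u} L.Structure} (f : M₀ ↪[L] M₁) (g : M₁ ↪[L] M₂),
    (K.restrict {lam}).IsEmb f → (K.restrict {lam}).IsEmb g → ∀ p ∈ K.S M₂,
    s.DoesNotFork g p → s.DoesNotFork f (p.restrict g.toEmbedding) →
    s.DoesNotFork (g.comp f) p

end PreFrame

end AbstractClass

/-! Categoricity supplies the saturation that amalgamation would usually give. If κ = κ^θ, a model
of size κ closed under all solvable extension problems for a given configuration over at most θ
parameters is obtained by iterating θ⁺ times. Categoricity in κ transfers this closure to every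
submodel of size κ of a larger model, so a model of size at least κ contains a copy, over the given
parameters, of each configuration of size at most θ that occurs in an extension
(`IsAEC.rich_of_categorical`). Models of size μ are thus rich for every θ < μ.

Nonsplitting over a family `B` says that a type cannot tell apart two embeddings of a model that
agree on `B`. By tameness, failures show on small sets, which richness can copy. Copying into the
base gives uniqueness and transitivity (`Setting.unique`, `Setting.trans`). For local character
(`Setting.localCharacter`), suppose that the type splits over every member of a small cover. Some
element of the model realizes the type over all witnesses together; it lies in one member of the
cover, where the two embeddings agree, a contradiction.

For extensions (`Setting.exists_nonSplit_extension`), cofinality ω makes the larger model the union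
of an ω-chain of smaller ones. Each is copied into the base model over `B`, and the given type is
pulled back. Nonsplitting makes the pullbacks increase, and coherence yields a type over the union,
nonsplitting over `B` by local character and transitivity.

Extension of types and weak amalgamation let a partial embedding grow by one element, whence
amalgamation after μ steps (`Setting.amalgamation`). Nonalgebraic types extend to nonalgebraic
types, so there are no maximal models above a non-maximal one. A type is coded by a natural number
and an element, whence stability. Reducts are injective on types over models of `K_M` (`red_injOn`),
which carries all this to the frame. -/

namespace AbstractClass

open Cardinal

variable {L : FirstOrder.Language.{u, u}} {K : AbstractClass L}

/-! ### Embeddings and submodels -/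

/-- An embedding whose range is contained in that of another one factors through it. -/
theorem exists_factor {M₀ M₁ N : Bundled.{u} L.Structure} (f : M₀ ↪[L] N) (g : M₁ ↪[L] N)
    (h : ∀ x, f x ∈ Set.range g) : ∃ t : M₀ ↪[L] M₁, ∀ x, g (t x) = f x := by
  choose t ht using h
  refine ⟨⟨⟨t, fun x y hxy => f.injective (by rw [← ht x, ← ht y, hxy])⟩, ?_, ?_⟩, ht⟩
  · intro n F x
    apply g.injective
    change g (t _) = g _
    rw [ht, g.map_fun, f.map_fun]
    congr 1
    funext k
    exact (ht (x k)).symm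
  · intro n R x
    change Structure.RelMap R (t ∘ x) ↔ _
    rw [← g.map_rel, ← f.map_rel]
    have : g ∘ t ∘ x = f ∘ x := by
      funext k
      exact ht (x k)
    rw [this]

theorem isEmb_refl {M : Bundled.{u} L.Structure} (h : K.Mem M) :
    K.IsEmb (Embedding.refl L M) := by
  exact K.isEmb_equiv (Language.Equiv.refl L M) h

theorem IsAEC.isEmb_of_comp (hK : K.IsAEC) {M₀ M₁ M₂ : Bundled.{u} L.Structure}
    {f : M₀ ↪[L] M₁} {g : M₁ ↪[L] M₂} (hg : K.IsEmb g) (h : K.IsEmb (g.comp f)) : K.IsEmb f :=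
  hK.coherence f g (K.mem_dom hg) hg h

theorem IsAEC.exists_factor (hK : K.IsAEC) {M₀ M₁ N : Bundled.{u} L.Structure}
    {f : M₀ ↪[L] N} {g : M₁ ↪[L] N} (hf : K.IsEmb f) (hg : K.IsEmb g)
    (h : ∀ x, f x ∈ Set.range g) : ∃ t : M₀ ↪[L] M₁, K.IsEmb t ∧ ∀ x, g (t x) = f x := by
  obtain ⟨t, ht⟩ := AbstractClass.exists_factor f g h
  refine ⟨t, hK.isEmb_of_comp hg ?_, ht⟩
  have : g.comp t = f := by ext x; exact ht x
  rwa [this]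

theorem IsAEC.isLSNumber (hK : K.IsAEC) : K.IsLSNumber K.LS :=
  csInf_mem (s := {κ | K.IsLSNumber κ}) hK.lowenheimSkolemTarski

theorem IsAEC.aleph0_le_LS (hK : K.IsAEC) : ℵ₀ ≤ K.LS :=
  le_trans le_add_self hK.isLSNumber.1

theorem IsAEC.exists_submodel_le (hK : K.IsAEC) {N : Bundled.{u} L.Structure} (hN : K.Mem N)
    (X : Set N) {κ : Cardinal.{u}} (hκ : K.LS ≤ κ) (hX : #X ≤ κ) :
    ∃ (M : Bundled.{u} L.Structure) (f : M ↪[L] N), K.IsEmb f ∧ X ⊆ Set.range f ∧ #M ≤ κ := by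
  obtain ⟨M, f, hf, hXf, hM⟩ := hK.isLSNumber.2 N hN X
  refine ⟨M, f, hf, hXf, hM.trans ?_⟩
  exact add_le_of_le (hK.aleph0_le_LS.trans hκ) hX hκ

/-- Adjoining κ further elements before taking the hull makes its size exactly κ. -/
theorem IsAEC.exists_submodel_eq (hK : K.IsAEC) {N : Bundled.{u} L.Structure} (hN : K.Mem N)
    (X : Set N) {κ : Cardinal.{u}} (hκ : K.LS ≤ κ) (hX : #X ≤ κ) (hκN : κ ≤ #N) :
    ∃ (M : Bundled.{u} L.Structure) (f : M ↪[L] N), K.IsEmb f ∧ X ⊆ Set.range f ∧ #M = κ := by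
  obtain ⟨Y, hY⟩ := Cardinal.le_mk_iff_exists_set.1 hκN
  obtain ⟨M, f, hf, hXf, hM⟩ := hK.exists_submodel_le hN (X ∪ Y) hκ
    ((mk_union_le _ _).trans (add_le_of_le (hK.aleph0_le_LS.trans hκ) hX hY.le))
  refine ⟨M, f, hf, Set.subset_union_left.trans hXf, le_antisymm hM ?_⟩
  rw [← hY]
  calc #Y ≤ #(Set.range f) := mk_le_mk_of_subset (Set.subset_union_right.trans hXf)
    _ ≤ #M := mk_range_le

theorem mk_le_of_embedding {M N : Bundled.{u} L.Structure} (f : M ↪[L] N) : #M ≤ #N :=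
  mk_le_of_injective f.injective

/-! ### Types -/

theorem GTp.restrict_restrict {A B C : Type u} (p : K.GTp A) (g : B ↪ A) (h : C ↪ B) :
    (p.restrict g).restrict h = p.restrict (h.trans g) := by
  induction p using Quot.ind
  rfl

theorem restrict_tp {A B : Type u} {N : Bundled.{u} L.Structure} (hN : K.Mem N) (i : A ↪ N)
    (b : N) (g : B ↪ A) : (K.tp hN i b).restrict g = K.tp hN (g.trans i) b := rfl

/-- Types are invariant under `K`-embeddings. -/
theorem tp_eq_tp_of_isEmb {A : Type u} {N N' : Bundled.{u} L.Structure} {f : N ↪[L] N'}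
    (hf : K.IsEmb f) (hN : K.Mem N) (hN' : K.Mem N') {i : A ↪ N} {j : A ↪ N'} {b : N} {c : N'}
    (hij : ∀ a, f (i a) = j a) (hbc : f b = c) : K.tp hN i b = K.tp hN' j c :=
  Quot.sound ⟨N', f, Embedding.refl L N', hf, isEmb_refl hN', hij, hbc⟩

theorem GTp.restrict_congr {A B : Type u} (p : K.GTp A) {g h : B ↪ A} (hgh : ∀ b, g b = h b) :
    p.restrict g = p.restrict h := by
  have : g = h := by ext b; exact hgh b
  rw [this]

theorem tp_mem_S {M N : Bundled.{u} L.Structure} {f : M ↪[L] N} (hf : K.IsEmb f) (hN : K.Mem N)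
    (b : N) : K.tp hN f.toEmbedding b ∈ K.S M := ⟨N, f, hf, b, rfl⟩

theorem restrict_mem_S {M N : Bundled.{u} L.Structure} {m : M ↪[L] N} (hm : K.IsEmb m)
    {p : K.GTp N} (hp : p ∈ K.S N) : p.restrict m.toEmbedding ∈ K.S M := by
  obtain ⟨N', f, hf, b, rfl⟩ := hp
  exact ⟨N', f.comp m, K.isEmb_comp hm hf, b, rfl⟩

/-- The type `p` contains the formula `v = x`. -/
def GTp.IsEq {A : Type u} (p : K.GTp A) (x : A) : Prop :=
  Quot.lift (fun t : K.Triple A => t.elt = t.incl x) (by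
    rintro t₁ t₂ ⟨N, f, g, -, -, h, hb⟩
    refine propext ⟨fun h' => ?_, fun h' => ?_⟩
    · apply g.injective
      rw [← hb, ← h, h']
    · apply f.injective
      rw [hb, h, h']) p

theorem isEq_tp {A : Type u} {N : Bundled.{u} L.Structure} (hN : K.Mem N) (i : A ↪ N) (b : N)
    (x : A) : (K.tp hN i b).IsEq x ↔ b = i x := Iff.rfl

theorem isEq_restrict {A B : Type u} (p : K.GTp A) (g : B ↪ A) (x : B) :
    (p.restrict g).IsEq x ↔ p.IsEq (g x) := by
  induction p using Quot.ind
  rfl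

/-- Equality with a parameter is preserved by atomic equivalence, so algebraicity can be read off
any representative. -/
theorem isAlgebraic_iff {M : Bundled.{u} L.Structure} {p : K.GTp M} (hp : p ∈ K.S M) :
    K.IsAlgebraic M p ↔ ∃ x, p.IsEq x := by
  constructor
  · rintro ⟨N, f, hf, a, rfl⟩
    exact ⟨a, rfl⟩
  · rintro ⟨x, hx⟩
    obtain ⟨N, f, hf, b, rfl⟩ := hp
    refine ⟨N, f, hf, x, ?_⟩
    rw [isEq_tp] at hx
    subst hx
    rfl

theorem isAlgebraic_tp_iff {M N : Bundled.{u} L.Structure} {f : M ↪[L] N} (hf : K.IsEmb f)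
    (hN : K.Mem N) (b : N) :
    K.IsAlgebraic M (K.tp hN f.toEmbedding b) ↔ b ∈ Set.range f := by
  rw [isAlgebraic_iff (tp_mem_S hf hN b)]
  exact ⟨fun ⟨x, hx⟩ => ⟨x, hx.symm⟩, fun ⟨x, hx⟩ => ⟨x, hx.symm⟩⟩

/-! ### Types in restrictions of the class -/

section Restrict

variable {Θ : Set Cardinal.{u}}

/-- The type of `K` given by a type of a restriction of `K`. -/
def GTp.ofRestrict {A : Type u} (p : (K.restrict Θ).GTp A) : K.GTp A :=
  Quot.map (fun t : (K.restrict Θ).Triple A => (⟨t.model, t.mem.1, t.incl, t.elt⟩ : K.Triple A))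
    (fun _ _ ⟨N, f, g, hf, hg, h, hb⟩ => ⟨N, f, g, hf.1, hg.1, h, hb⟩) p

theorem ofRestrict_restrict {A B : Type u} (p : (K.restrict Θ).GTp A) (g : B ↪ A) :
    GTp.ofRestrict (p.restrict g) = (GTp.ofRestrict p).restrict g := by
  induction p using Quot.ind
  rfl

theorem ofRestrict_tp {A : Type u} {N : Bundled.{u} L.Structure} (hN : (K.restrict Θ).Mem N)
    (i : A ↪ N) (b : N) : GTp.ofRestrict ((K.restrict Θ).tp hN i b) = K.tp hN.1 i b := rfl

/-- Models containing `A` can be shrunk to models with cardinality in `Θ`. -/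
structure Shrinks (K : AbstractClass L) (Θ : Set Cardinal.{u}) (A : Type u) : Prop where
  triple : ∀ {N : Bundled.{u} L.Structure}, K.Mem N → ∀ (i : A ↪ N) (b : N),
    ∃ (M : Bundled.{u} L.Structure) (f : M ↪[L] N), K.IsEmb f ∧ #M ∈ Θ ∧
      (∀ a, i a ∈ Set.range f) ∧ b ∈ Set.range f
  pair : ∀ {N M₁ M₂ : Bundled.{u} L.Structure} {f₁ : M₁ ↪[L] N} {f₂ : M₂ ↪[L] N},
    K.IsEmb f₁ → K.IsEmb f₂ → #M₁ ∈ Θ → #M₂ ∈ Θ →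
    ∃ (M : Bundled.{u} L.Structure) (f : M ↪[L] N), K.IsEmb f ∧ #M ∈ Θ ∧
      (∀ x, f₁ x ∈ Set.range f) ∧ (∀ x, f₂ x ∈ Set.range f)

/-- The triple `s` of the restriction of `K` lies inside the triple `t`. -/
def SubTriple {A : Type u} (s : (K.restrict Θ).Triple A) (t : K.Triple A) : Prop :=
  ∃ f : s.model ↪[L] t.model, K.IsEmb f ∧ (∀ a, f (s.incl a) = t.incl a) ∧ f s.elt = t.elt

theorem Shrinks.exists_subTriple {A : Type u} (h : K.Shrinks Θ A) (t : K.Triple A) :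
    ∃ s : (K.restrict Θ).Triple A, SubTriple s t := by
  obtain ⟨M, f, hf, hM, hi, b, hb⟩ := h.triple t.mem t.incl t.elt
  choose i hi using hi
  exact ⟨⟨M, ⟨K.mem_dom hf, hM⟩, ⟨i, fun x y hxy => t.incl.injective
    (by rw [← hi x, ← hi y, hxy])⟩, b⟩, f, hf, hi, hb⟩

/-- Inside the common extension both small models lie in one small model, and coherence makes the
inclusions into it `K`-embeddings. -/
theorem Shrinks.eAt_of_subTriple {A : Type u} (h : K.Shrinks Θ A) (hK : K.IsAEC)
    {t t' : K.Triple A} (htt' : K.EAt t t') {s s' : (K.restrict Θ).Triple A}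
    (hs : SubTriple s t) (hs' : SubTriple s' t') : (K.restrict Θ).EAt s s' := by
  obtain ⟨N, f, f', hf, hf', hA, hb⟩ := htt'
  obtain ⟨g, hg, hgA, hgb⟩ := hs
  obtain ⟨g', hg', hgA', hgb'⟩ := hs'
  have e := K.isEmb_comp hg hf
  have e' := K.isEmb_comp hg' hf'
  obtain ⟨P, k, hk, hP, h1, h2⟩ := h.pair e e' s.mem.2 s'.mem.2
  obtain ⟨r, hr, hrk⟩ := hK.exists_factor e hk h1
  obtain ⟨r', hr', hrk'⟩ := hK.exists_factor e' hk h2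
  refine ⟨P, r, r', ⟨hr, s.mem.2, hP⟩, ⟨hr', s'.mem.2, hP⟩, fun a => ?_, ?_⟩
  · apply k.injective
    rw [hrk, hrk', Embedding.comp_apply, Embedding.comp_apply, hgA, hgA', hA]
  · apply k.injective
    rw [hrk, hrk', Embedding.comp_apply, Embedding.comp_apply, hgb, hgb', hb]

theorem EAt.refl {A : Type u} (t : K.Triple A) : K.EAt t t :=
  ⟨t.model, Embedding.refl L _, Embedding.refl L _, isEmb_refl t.mem, isEmb_refl t.mem,
    fun _ => rfl, rfl⟩

/-- Passing to a small subtriple is a left inverse. It respects the generated equivalence because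
each atomic step shrinks, so no amalgamation is needed. -/
theorem Shrinks.ofRestrict_injective {A : Type u} (h : K.Shrinks Θ A) (hK : K.IsAEC) :
    Function.Injective (GTp.ofRestrict : (K.restrict Θ).GTp A → K.GTp A) := by
  let back : K.GTp A → (K.restrict Θ).GTp A :=
    Quot.lift (fun t => Quot.mk _ (h.exists_subTriple t).choose) (fun t t' htt' =>
      Quot.sound (h.eAt_of_subTriple hK htt' (h.exists_subTriple t).choose_spec
        (h.exists_subTriple t').choose_spec))
  have hback : ∀ p, back (GTp.ofRestrict p) = p := by
    intro p
    induction p using Quot.ind with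
    | mk s =>
      let t : K.Triple A := ⟨s.model, s.mem.1, s.incl, s.elt⟩
      have hst : SubTriple s t :=
        ⟨Embedding.refl L _, isEmb_refl s.mem.1, fun _ => rfl, rfl⟩
      exact Quot.sound (h.eAt_of_subTriple hK (EAt.refl t)
        (h.exists_subTriple t).choose_spec hst)
  exact Function.LeftInverse.injective hback

theorem Shrinks.exists_ofRestrict_eq {M : Bundled.{u} L.Structure} (h : K.Shrinks Θ M)
    (hK : K.IsAEC) (hM : #M ∈ Θ) {p : K.GTp M} (hp : p ∈ K.S M) :
    ∃ q ∈ (K.restrict Θ).S M, GTp.ofRestrict q = p := by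
  obtain ⟨N, f, hf, b, rfl⟩ := hp
  obtain ⟨P, k, hk, hP, h1, c, rfl⟩ := h.triple (K.mem_cod hf) f.toEmbedding b
  obtain ⟨r, hr, hrk⟩ := hK.exists_factor hf hk h1
  exact ⟨_, tp_mem_S (K := K.restrict Θ) (f := r) ⟨hr, hM, hP⟩ ⟨K.mem_dom hk, hP⟩ c,
    tp_eq_tp_of_isEmb hk _ _ hrk rfl⟩

end Restrict

/-! ### Shrinking models to size at most, below, or equal to μ -/

section Shrinking

variable {μ : Cardinal.{u}}

theorem mk_union_range_le {α β γ : Type u} (hμ : ℵ₀ ≤ μ) (f : α → γ) (g : β → γ) (hα : #α ≤ μ)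
    (hβ : #β ≤ μ) : #(Set.range f ∪ Set.range g : Set γ) ≤ μ :=
  (mk_union_le _ _).trans (add_le_of_le hμ (mk_range_le.trans hα) (mk_range_le.trans hβ))

theorem IsAEC.shrinks_Iic (hK : K.IsAEC) (hμ : K.LS ≤ μ) {A : Type u} (hA : #A ≤ μ) :
    K.Shrinks (Set.Iic μ) A where
  triple {N} hN i b := by
    obtain ⟨M, f, hf, h, hM⟩ := hK.exists_submodel_le hN
      (Set.range i ∪ Set.range (fun _ : PUnit.{u + 1} => b)) hμ
      (mk_union_range_le (hK.aleph0_le_LS.trans hμ) _ _ hA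
        (by rw [mk_punit]; exact one_le_aleph0.trans (hK.aleph0_le_LS.trans hμ)))
    exact ⟨M, f, hf, hM, fun a => h (Or.inl ⟨a, rfl⟩), h (Or.inr ⟨⟨⟩, rfl⟩)⟩
  pair {N M₁ M₂ f₁ f₂} h₁ h₂ c₁ c₂ := by
    obtain ⟨M, f, hf, h, hM⟩ := hK.exists_submodel_le (K.mem_cod h₁)
      (Set.range f₁ ∪ Set.range f₂) hμ
      (mk_union_range_le (hK.aleph0_le_LS.trans hμ) _ _ c₁ c₂)
    exact ⟨M, f, hf, hM, fun a => h (Or.inl ⟨a, rfl⟩), fun a => h (Or.inr ⟨a, rfl⟩)⟩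

theorem IsAEC.shrinks_Iio (hK : K.IsAEC) (hμ : K.LS < μ) {A : Type u} (hA : #A < μ) :
    K.Shrinks (Set.Iio μ) A where
  triple {N} hN i b := by
    obtain ⟨M, f, hf, hM, h⟩ := (hK.shrinks_Iic (le_max_left K.LS #A)
      (le_max_right K.LS #A)).triple hN i b
    exact ⟨M, f, hf, lt_of_le_of_lt hM (max_lt hμ hA), h⟩
  pair {N M₁ M₂ f₁ f₂} h₁ h₂ c₁ c₂ := by
    obtain ⟨M, f, hf, hM, h⟩ := (hK.shrinks_Iic (μ := max K.LS (max #M₁ #M₂)) (A := M₁)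
      (le_max_left _ _) (le_max_of_le_right (le_max_left _ _))).pair h₁ h₂
      (Set.mem_Iic.2 (le_max_of_le_right (le_max_left _ _)))
      (Set.mem_Iic.2 (le_max_of_le_right (le_max_right _ _)))
    exact ⟨M, f, hf, lt_of_le_of_lt hM (max_lt hμ (max_lt c₁ c₂)), h⟩

theorem IsAEC.shrinks_singleton (hK : K.IsAEC) (hμ : K.LS ≤ μ) {A : Type u} (hA : #A = μ) :
    K.Shrinks {μ} A where
  triple {N} hN i b := by
    obtain ⟨M, f, hf, hM, h, h'⟩ := (hK.shrinks_Iic hμ hA.le).triple hN i b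
    refine ⟨M, f, hf, le_antisymm hM ?_, h, h'⟩
    choose j hj using h
    rw [← hA]
    exact mk_le_of_injective (f := j) fun x y hxy => i.injective (by rw [← hj x, ← hj y, hxy])
  pair {N M₁ M₂ f₁ f₂} h₁ h₂ c₁ c₂ := by
    obtain ⟨M, f, hf, hM, h, h'⟩ := (hK.shrinks_Iic hμ hA.le).pair h₁ h₂ (Eq.le c₁) (Eq.le c₂)
    refine ⟨M, f, hf, le_antisymm hM ?_, h, h'⟩
    obtain ⟨t, -⟩ := AbstractClass.exists_factor f₁ f h
    rw [← Set.mem_singleton_iff.1 c₁]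
    exact mk_le_of_embedding t

end Shrinking

/-- Types over models of cardinality at most `μ` are determined by their restrictions to sets of
cardinality at most `LS(K)`. -/
theorem IsAEC.eq_of_tame (hK : K.IsAEC) {μ : Cardinal.{u}} (hμ : K.LS ≤ μ)
    (ht : (K.restrict (Set.Iic μ)).Tame K.LS) {M : Bundled.{u} L.Structure} (hM : #M ≤ μ)
    {p q : K.GTp M} (hp : p ∈ K.S M) (hq : q ∈ K.S M)
    (h : ∀ A : Set M, #A ≤ K.LS → p.restrict (Function.Embedding.subtype (· ∈ A)) =
      q.restrict (Function.Embedding.subtype (· ∈ A))) : p = q := by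
  have hs := hK.shrinks_Iic hμ hM
  obtain ⟨p', hp', rfl⟩ := hs.exists_ofRestrict_eq hK hM hp
  obtain ⟨q', hq', rfl⟩ := hs.exists_ofRestrict_eq hK hM hq
  by_contra hne
  have hMK : K.Mem M := by
    obtain ⟨N, f, hf, -⟩ := hp
    exact K.mem_dom hf
  obtain ⟨A, hA, hne'⟩ := ht M ⟨hMK, hM⟩ p' hp' q' hq' (fun h => hne (h ▸ rfl))
  have hA' := Order.lt_succ_iff.1 hA
  apply hne'
  apply (hK.shrinks_Iic hμ (hA'.trans hμ)).ofRestrict_injective hK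
  rw [ofRestrict_restrict, ofRestrict_restrict]
  exact h A hA'

/-- Weak amalgamation, for types of `K`. -/
theorem IsAEC.weakAmalgamation (hK : K.IsAEC) {μ : Cardinal.{u}} (hμ : K.LS ≤ μ)
    (hw : (K.restrict {μ}).WeakAmalgamation) {M N₁ N₂ : Bundled.{u} L.Structure}
    {i₁ : M ↪[L] N₁} {i₂ : M ↪[L] N₂} (h₁ : K.IsEmb i₁) (h₂ : K.IsEmb i₂)
    (hM : #M = μ) (hN₁ : #N₁ = μ) (hN₂ : #N₂ = μ) {a₁ : N₁} {a₂ : N₂}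
    (ha : K.tp (K.mem_cod h₁) i₁.toEmbedding a₁ = K.tp (K.mem_cod h₂) i₂.toEmbedding a₂) :
    ∃ (P₁ N₂' : Bundled.{u} L.Structure) (j : M ↪[L] P₁) (k : P₁ ↪[L] N₁)
      (l : N₂ ↪[L] N₂') (f : P₁ ↪[L] N₂'),
      K.IsEmb j ∧ K.IsEmb k ∧ K.IsEmb l ∧ K.IsEmb f ∧ #P₁ = μ ∧ #N₂' = μ ∧
      (∀ x : M, k (j x) = i₁ x) ∧ a₁ ∈ Set.range k ∧ (∀ x : M, f (j x) = l (i₂ x)) := by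
  obtain ⟨P₁, N₂', j, k, l, f, c, hj, hk, hl, hf, e₁, e₂, e₃, -⟩ :=
    hw i₁ i₂ ⟨h₁, hM, hN₁⟩ ⟨h₂, hM, hN₂⟩ a₁ a₂
      ((hK.shrinks_singleton hμ hM).ofRestrict_injective hK ha)
  exact ⟨P₁, N₂', j, k, l, f, hj.1, hk.1, hl.1, hf.1, hj.2.2, hl.2.2, e₁, ⟨c, e₂⟩, e₃⟩

/-! ### Unions of directed systems -/

section Union

theorem System.directedSystem {I : Type u} [Preorder I] (D : K.System I) :
    DirectedSystem (fun i => D.obj i) (fun _ _ h => D.map h) :=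
  ⟨fun _ x => D.map_refl _ x, fun _ _ _ hij hjk x => D.map_map hij hjk x⟩

variable {I : Type u} [Preorder I] [IsDirectedOrder I] [Nonempty I]

theorem System.exists_isUnion (D : K.System I) :
    ∃ (M : Bundled.{u} L.Structure) (g : ∀ i, D.obj i ↪[L] M), D.IsUnion M g := by
  have := D.directedSystem
  refine ⟨⟨Language.DirectLimit (fun i => D.obj i) (fun _ _ h => D.map h), inferInstance⟩,
    fun i => Language.DirectLimit.of L I (fun i => D.obj i) (fun _ _ h => D.map h) i, ?_, ?_⟩
  · intro i j h x
    exact Language.DirectLimit.of_f (G := fun i => D.obj i) (f := fun _ _ h => D.map h)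
  · intro x
    exact Language.DirectLimit.exists_of x

/-- A union in the sense of `IsUnion` is isomorphic to the direct limit, since the comparison map is
onto; the universal property is transported along its inverse, and Tarski–Vaught makes the resulting
map a `K`-embedding. -/
theorem IsAEC.exists_desc (hK : K.IsAEC) {D : K.System I} {M : Bundled.{u} L.Structure}
    {g : ∀ i, D.obj i ↪[L] M} (hg : D.IsUnion M g) {P : Bundled.{u} L.Structure}
    {h : ∀ i, D.obj i ↪[L] P} (hh : ∀ i, K.IsEmb (h i))
    (hc : ∀ (i j : I) (hij : i ≤ j) (x : D.obj i), h j (D.map hij x) = h i x) :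
    ∃ t : M ↪[L] P, K.IsEmb t ∧ ∀ i x, t (g i x) = h i x := by
  have := D.directedSystem
  let l := Language.DirectLimit.lift L I (fun i => D.obj i) (fun _ _ h => D.map h) g hg.1
  let l' := Language.DirectLimit.lift L I (fun i => D.obj i) (fun _ _ h => D.map h) h hc
  let Q : Bundled.{u} L.Structure :=
    ⟨Language.DirectLimit (fun i => D.obj i) (fun _ _ h => D.map h), inferInstance⟩
  have hl : ∀ i x,
      l (Language.DirectLimit.of L I (fun i => D.obj i) (fun _ _ h => D.map h) i x) = g i x :=
    fun i x => Language.DirectLimit.lift_of _ _ _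
  have hl' : ∀ i x,
      l' (Language.DirectLimit.of L I (fun i => D.obj i) (fun _ _ h => D.map h) i x) = h i x :=
    fun i x => Language.DirectLimit.lift_of _ _ _
  obtain ⟨s, hs⟩ := AbstractClass.exists_factor (M₀ := M) (M₁ := Q) (Embedding.refl L M) l (by
    intro x
    obtain ⟨i, y, rfl⟩ := hg.2 x
    exact ⟨_, hl i y⟩)
  have key : ∀ i x, s (g i x) =
      Language.DirectLimit.of L I (fun i => D.obj i) (fun _ _ h => D.map h) i x := by
    intro i x
    apply l.injective
    exact (hs _).trans (hl i x).symm
  have hcomp : ∀ i x, (l'.comp s) (g i x) = h i x := by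
    intro i x
    rw [Embedding.comp_apply, key]
    exact hl' i x
  refine ⟨l'.comp s, ?_, hcomp⟩
  refine hK.union_le I D M g hg P _ ?_ ?_
  · exact K.mem_cod (hh (Classical.arbitrary I))
  · intro i
    have : (l'.comp s : M ↪[L] P).comp (g i) = h i := by
      ext x
      exact hcomp i x
    rw [this]
    exact hh i

end Union

/-! ### Transfinite iteration -/

/-- Iterating inflationary maps `S w` along a well-order, in a preorder with upper bounds for
short chains. -/
theorem exists_iteration {T : Type*} [Preorder T] {W : Type*} [LinearOrder W] [WellFoundedLT W]
    (x₀ : T)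
    (hub : ∀ (w : W) (X : {v // v < w} → T), Monotone X → (∀ v, x₀ ≤ X v) →
      ∃ z, x₀ ≤ z ∧ ∀ v, X v ≤ z)
    (S : W → T → T) (hS : ∀ w x, x ≤ S w x) :
    ∃ X : W → T, Monotone X ∧ (∀ w, x₀ ≤ X w) ∧
      ∀ w, ∃ z, x₀ ≤ z ∧ (∀ v < w, X v ≤ z) ∧ X w = S w z := by
  classical
  let F : ∀ w : W, (∀ v, v < w → T) → T := fun w X =>
    -- The default `x₀` is never reached: the induction below shows that a bound exists.
    S w (if h : ∃ z, x₀ ≤ z ∧ ∀ v hv, X v hv ≤ z then h.choose else x₀)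
  let X : W → T := wellFounded_lt.fix F
  have hX : ∀ w, X w = F w (fun v _ => X v) := fun w => wellFounded_lt.fix_eq F w
  have key : ∀ w, ∃ z, x₀ ≤ z ∧ (∀ v < w, X v ≤ z) ∧ X w = S w z := by
    intro w
    induction w using WellFoundedLT.induction with
    | ind w ih =>
      have h : ∃ z, x₀ ≤ z ∧ ∀ v, v < w → X v ≤ z := by
        obtain ⟨z, hz, hz'⟩ := hub w (fun v => X v) (by
          rintro ⟨v, hv⟩ ⟨v', hv'⟩ hvv'
          rcases (show v ≤ v' from hvv').eq_or_lt with h | h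
          · subst h; exact le_rfl
          · obtain ⟨z, -, hz, hz'⟩ := ih v' hv'
            change X v ≤ X v'
            rw [hz']
            exact (hz v h).trans (hS _ _)) (by
          rintro ⟨v, hv⟩
          obtain ⟨z, hz, -, hz'⟩ := ih v hv
          change x₀ ≤ X v
          rw [hz']
          exact hz.trans (hS _ _))
        exact ⟨z, hz, fun v hv => hz' ⟨v, hv⟩⟩
      refine ⟨h.choose, h.choose_spec.1, h.choose_spec.2, ?_⟩
      rw [hX]
      change S w (dite _ _ _) = _
      rw [dif_pos h]
  refine ⟨X, ?_, ?_, key⟩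
  · intro v w hvw
    rcases hvw.eq_or_lt with h | h
    · rw [h]
    · obtain ⟨z, -, hz, hz'⟩ := key w
      rw [hz']
      exact (hz v h).trans (hS _ _)
  · intro w
    obtain ⟨z, hz, -, hz'⟩ := key w
    rw [hz']
    exact hz.trans (hS _ _)

/-! ### Models on subsets of a fixed set -/

/-- A model in `K` whose universe is a subset of `Ω`. -/
structure CModel (K : AbstractClass L) (Ω : Type u) where
  carrier : Set Ω
  str : L.Structure carrier
  mem : K.Mem ⟨carrier, str⟩

namespace CModel

variable {Ω : Type u}

/-- The underlying model. -/
def toB (X : CModel K Ω) : Bundled.{u} L.Structure := ⟨X.carrier, X.str⟩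

/-- The element of `Ω` given by an element of the model. -/
def val {X : CModel K Ω} (x : X.toB) : Ω := Subtype.val (p := (· ∈ X.carrier)) x

theorem val_injective {X : CModel K Ω} : Function.Injective (val (X := X)) :=
  Subtype.val_injective

theorem val_mem {X : CModel K Ω} (x : X.toB) : val x ∈ X.carrier :=
  Subtype.property (p := (· ∈ X.carrier)) x

theorem exists_val_eq {X : CModel K Ω} {ω : Ω} (h : ω ∈ X.carrier) : ∃ x : X.toB, val x = ω :=
  ⟨⟨ω, h⟩, rfl⟩

/-- Inclusions act as the identity on elements of `Ω`, so `val` determines them and chains commute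
automatically. -/
instance : Preorder (CModel K Ω) where
  le X Y := ∃ e : X.toB ↪[L] Y.toB, K.IsEmb e ∧ ∀ x, val (e x) = val x
  le_refl X := ⟨Embedding.refl L _, isEmb_refl X.mem, fun _ => rfl⟩
  le_trans X Y Z := fun ⟨e, he, he'⟩ ⟨f, hf, hf'⟩ =>
    ⟨f.comp e, K.isEmb_comp he hf, fun x => by rw [Embedding.comp_apply, hf', he']⟩

/-- The inclusion. -/
noncomputable def incl {X Y : CModel K Ω} (h : X ≤ Y) : X.toB ↪[L] Y.toB := h.choose

theorem isEmb_incl {X Y : CModel K Ω} (h : X ≤ Y) : K.IsEmb (incl h) := h.choose_spec.1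

theorem val_incl {X Y : CModel K Ω} (h : X ≤ Y) (x : X.toB) : val (incl h x) = val x :=
  h.choose_spec.2 x

theorem carrier_subset {X Y : CModel K Ω} (h : X ≤ Y) : X.carrier ⊆ Y.carrier := by
  intro ω hω
  obtain ⟨x, rfl⟩ := exists_val_eq hω
  rw [← val_incl h]
  exact val_mem _

/-- A model can be transported along an injection into `Ω`. -/
theorem exists_equiv {M : Bundled.{u} L.Structure} (hM : K.Mem M) {j : M → Ω}
    (hj : Function.Injective j) :
    ∃ (X : CModel K Ω) (e : M ≃[L] X.toB), ∀ m, val (e m) = j m := by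
  let g := Equiv.ofInjective j hj
  let e : M ≃[L] (g.bundledInduced L) := g.bundledInducedEquiv L
  exact ⟨⟨Set.range j, (g.bundledInduced L).str, K.mem_cod (K.isEmb_equiv e hM)⟩, e,
    fun m => rfl⟩

/-- An extension of a model on a subset of `Ω` can be realized on a subset of `Ω`. -/
theorem exists_extension {X : CModel K Ω} {N : Bundled.{u} L.Structure} {f : X.toB ↪[L] N}
    (hf : K.IsEmb f) (hΩ : ℵ₀ ≤ #Ω) (hX : #X.toB < #Ω) (hN : #N < #Ω) :
    ∃ (Y : CModel K Ω) (e : N ≃[L] Y.toB), X ≤ Y ∧ ∀ x, val (e (f x)) = val x := by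
  classical
  -- The infinite cardinal `#Ω` is not a sum of two smaller ones, so the complement of `X` has room
  -- for the new elements of `N`; the old ones keep their place.
  have hc : #N ≤ #(X.carrierᶜ : Set Ω) := by
    have h := mk_sum_compl X.carrier
    by_contra hlt
    rw [not_le] at hlt
    exact absurd h (add_lt_of_lt hΩ hX (hlt.trans hN)).ne
  obtain ⟨k⟩ := hc
  let j : N → Ω := fun n => if h : ∃ x, f x = n then val h.choose else k n
  have hjf : ∀ x, j (f x) = val x := by
    intro x
    have h : ∃ y, f y = f x := ⟨x, rfl⟩
    change dite _ _ _ = _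
    rw [dif_pos h, f.injective h.choose_spec]
  have hjn : ∀ n, (¬ ∃ x, f x = n) → j n = k n := fun n h => dif_neg h
  have hj : Function.Injective j := by
    intro n n' hnn'
    by_cases h : ∃ x, f x = n <;> by_cases h' : ∃ x, f x = n'
    · obtain ⟨x, rfl⟩ := h
      obtain ⟨x', rfl⟩ := h'
      rw [hjf, hjf] at hnn'
      rw [val_injective hnn']
    · obtain ⟨x, rfl⟩ := h
      rw [hjf, hjn _ h'] at hnn'
      exact absurd (hnn' ▸ val_mem x) (k n').2
    · obtain ⟨x', rfl⟩ := h'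
      rw [hjf, hjn _ h] at hnn'
      exact absurd (hnn'.symm ▸ val_mem x') (k n).2
    · rw [hjn _ h, hjn _ h'] at hnn'
      exact k.injective (Subtype.ext hnn')
  obtain ⟨Y, e, he⟩ := exists_equiv (K.mem_cod hf) hj
  exact ⟨Y, e, ⟨e.toEmbedding.comp f, K.isEmb_comp hf (K.isEmb_equiv e (K.mem_cod hf)),
    fun x => (he _).trans (hjf x)⟩, fun x => (he _).trans (hjf x)⟩

variable {I : Type u} [Preorder I]

/-- A monotone family of models as a directed system. -/
noncomputable abbrev system {X : I → CModel K Ω} (hX : Monotone X) : K.System I where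
  obj i := (X i).toB
  map h := incl (hX h)
  isEmb h := isEmb_incl (hX h)
  map_refl i x := val_injective (val_incl _ _)
  map_map hij hjk x := val_injective (by rw [val_incl, val_incl, val_incl])

theorem exists_union (hK : K.IsAEC) [IsDirectedOrder I] [Nonempty I] {X : I → CModel K Ω}
    (hX : Monotone X) : ∃ (Y : CModel K Ω) (hY : ∀ i, X i ≤ Y),
      (∀ ω ∈ Y.carrier, ∃ i, ω ∈ (X i).carrier) ∧
      (system hX).IsUnion Y.toB (fun i => incl (hY i)) := by
  obtain ⟨M, g, hg⟩ := (system hX).exists_isUnion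
  obtain ⟨hM, hgE⟩ := hK.union I _ M g hg
  choose i y hy using hg.2
  -- The value does not depend on the chosen representative: two representatives coincide at a
  -- common later stage.
  let j : M → Ω := fun m => val (X := X (i m)) (y m)
  have hjg : ∀ i (x : (X i).toB), j (g i x) = val x := by
    intro k x
    obtain ⟨l, hl, hl'⟩ := exists_ge_ge (i (g k x)) k
    have h' := (g l).injective
      ((hg.1 _ _ hl _).trans ((hy (g k x)).trans (hg.1 _ _ hl' x).symm))
    have h'' := congrArg (val (X := X l)) h'
    rw [val_incl, val_incl] at h''
    exact h''
  have hj : Function.Injective j := by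
    intro m m' h
    obtain ⟨k, x, rfl⟩ := hg.2 m
    obtain ⟨k', x', rfl⟩ := hg.2 m'
    rw [hjg, hjg] at h
    obtain ⟨l, hl, hl'⟩ := exists_ge_ge k k'
    rw [← hg.1 _ _ hl, ← hg.1 _ _ hl']
    congr 1
    apply val_injective
    rw [val_incl, val_incl]
    exact h
  obtain ⟨Y, e, he⟩ := exists_equiv hM hj
  have hY : ∀ i, X i ≤ Y := fun i => ⟨e.toEmbedding.comp (g i),
    K.isEmb_comp (hgE i) (K.isEmb_equiv e hM), fun x => (he _).trans (hjg i x)⟩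
  refine ⟨Y, hY, ?_, ?_, ?_⟩
  · intro ω hω
    obtain ⟨y, rfl⟩ := exists_val_eq hω
    obtain ⟨m, rfl⟩ := e.surjective y
    obtain ⟨k, x, rfl⟩ := hg.2 m
    rw [he, hjg]
    exact ⟨k, val_mem x⟩
  · intro i j h x
    apply val_injective
    rw [val_incl, val_incl, val_incl]
  · intro y
    obtain ⟨m, rfl⟩ := e.surjective y
    obtain ⟨k, x, rfl⟩ := hg.2 m
    refine ⟨k, x, val_injective ?_⟩
    rw [he, hjg]
    exact val_incl _ _

theorem mk_union_le {I : Type u} {X : I → CModel K Ω} {Y : CModel K Ω}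
    (hY : ∀ ω ∈ Y.carrier, ∃ i, ω ∈ (X i).carrier) {κ : Cardinal.{u}} (hκ : ℵ₀ ≤ κ)
    (hI : #I ≤ κ) (hX : ∀ i, #(X i).toB ≤ κ) : #Y.toB ≤ κ := by
  have h1 : Y.carrier ⊆ ⋃ i, (X i).carrier := fun ω hω => Set.mem_iUnion.2 (hY ω hω)
  calc #Y.toB = #Y.carrier := rfl
    _ ≤ #(⋃ i, (X i).carrier) := mk_le_mk_of_subset h1
    _ ≤ Cardinal.sum fun i => #(X i).carrier := mk_iUnion_le_sum_mk
    _ ≤ Cardinal.sum fun _ : I => κ := Cardinal.sum_le_sum _ _ hX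
    _ = #I * κ := by simp
    _ ≤ κ * κ := mul_le_mul_left hI κ
    _ = κ := mul_eq_self hκ

end CModel

/-! ### Rich models -/

/-- `M` realizes every configuration of cardinality at most `θ` of any of its extensions. -/
def Rich (K : AbstractClass L) (θ : Cardinal.{u}) (M : Bundled.{u} L.Structure) : Prop :=
  ∀ {N C : Bundled.{u} L.Structure} (f : M ↪[L] N) (m : C ↪[L] N), K.IsEmb f → K.IsEmb m →
    #C ≤ θ → ∀ {B : Type u} (h : B → M) (j : B → C), (∀ b, m (j b) = f (h b)) →
    ∃ g : C ↪[L] M, K.IsEmb g ∧ ∀ b, g (j b) = h b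

theorem Rich.mono {θ θ' : Cardinal.{u}} {M : Bundled.{u} L.Structure} (h : K.Rich θ M)
    (hθ : θ' ≤ θ) : K.Rich θ' M :=
  fun f m hf hm hC _ _ _ hj => h f m hf hm (hC.trans hθ) _ _ hj

/-! ### Closure under solvable extension problems, and richness from categoricity -/

section Closure

variable {C : Bundled.{u} L.Structure} {A : Set C} {Ω : Type u} {κ : Cardinal.{u}}

/-- `C` embeds into the model `X` over `i`. -/
def CModel.Sol (C : Bundled.{u} L.Structure) (A : Set C) (i : A → Ω) (X : CModel K Ω) : Prop :=
  ∃ g : C ↪[L] X.toB, K.IsEmb g ∧ ∀ a : A, CModel.val (g a) = i a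

theorem CModel.Sol.mono {i : A → Ω} {X Y : CModel K Ω} (h : X.Sol C A i) (hXY : X ≤ Y) :
    Y.Sol C A i := by
  obtain ⟨g, hg, hgi⟩ := h
  exact ⟨(incl hXY).comp g, K.isEmb_comp hg (isEmb_incl hXY),
    fun a => (val_incl hXY _).trans (hgi a)⟩

/-- Models of cardinality `κ` on subsets of `Ω`. -/
abbrev CModelOf (K : AbstractClass L) (Ω : Type u) (κ : Cardinal.{u}) :=
  {X : CModel K Ω // #X.toB = κ}

/-- The bound is the union, or `x₀` for the empty chain. The last clause locates each element of the
union at an earlier stage. -/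
theorem exists_upperBound (hK : K.IsAEC) (hκ : ℵ₀ ≤ κ) {I : Type u} [LinearOrder I]
    (hI : #I ≤ κ) (x₀ : CModelOf K Ω κ) (X : I → CModelOf K Ω κ) (hX : Monotone X)
    (h₀ : ∀ i, x₀ ≤ X i) :
    ∃ z, x₀ ≤ z ∧ (∀ i, X i ≤ z) ∧
      (Nonempty I → ∀ ω ∈ z.1.carrier, ∃ i, ω ∈ (X i).1.carrier) := by
  rcases isEmpty_or_nonempty I with h | h
  · exact ⟨x₀, le_rfl, fun i => isEmptyElim i, fun h' => (not_isEmpty_of_nonempty I h).elim⟩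
  · obtain ⟨Y, hY, hYU, -⟩ := CModel.exists_union (X := fun i => (X i).1) hK hX
    have i := Classical.arbitrary I
    have hYκ : #Y.toB = κ := by
      refine le_antisymm (CModel.mk_union_le hYU hκ hI fun i => (X i).2.le) ?_
      rw [← (X i).2]
      exact mk_le_of_embedding (CModel.incl (hY i))
    exact ⟨⟨Y, hYκ⟩, (h₀ i).trans (hY i), hY, fun _ => hYU⟩

/-- Every model of cardinality `κ` has an extension solving all solvable extension problems over
small subsets of it. -/
theorem exists_solution (hK : K.IsAEC) (hκ : ℵ₀ ≤ κ) (hA : κ ^ #A ≤ κ) (x₀ : CModelOf K Ω κ) :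
    ∃ y, x₀ ≤ y ∧ ∀ i : A → Ω, (∀ a, i a ∈ x₀.1.carrier) →
      (∃ y' : CModelOf K Ω κ, y ≤ y' ∧ y'.1.Sol C A i) → y.1.Sol C A i := by
  classical
  let W := (#(A → x₀.1.carrier)).ord.ToType
  have hW : #W ≤ κ := by
    change #((#(A → x₀.1.carrier)).ord.ToType) ≤ κ
    rw [mk_ord_toType, mk_arrow]
    simp only [lift_id]
    have : #x₀.1.carrier = κ := x₀.2
    rw [this]
    exact hA
  have hWe : #W = #(A → x₀.1.carrier) := mk_ord_toType _
  obtain ⟨w⟩ := Cardinal.eq.1 hWe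
  -- Step `v` solves the `v`-th problem if some extension of size κ does, and otherwise changes
  -- nothing.
  let S : W → CModelOf K Ω κ → CModelOf K Ω κ := fun v x =>
    if h : ∃ y, x ≤ y ∧ y.1.Sol C A (fun a => (w v a : Ω)) then h.choose else x
  have hS : ∀ v x, x ≤ S v x := by
    intro v x
    change x ≤ dite _ _ _
    split_ifs with h
    · exact h.choose_spec.1
    · exact le_rfl
  have hS' : ∀ v x, (∃ y, x ≤ y ∧ y.1.Sol C A (fun a => (w v a : Ω))) →
      (S v x).1.Sol C A (fun a => (w v a : Ω)) := by
    intro v x h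
    change CModel.Sol C A _ (dite _ _ _ : CModelOf K Ω κ).1
    rw [dif_pos h]
    exact h.choose_spec.2
  obtain ⟨X, hX, hX₀, hXS⟩ := exists_iteration x₀ (fun v X hX h₀ => by
    obtain ⟨z, hz, hz', -⟩ := exists_upperBound hK hκ
      ((mk_le_of_injective Subtype.val_injective).trans hW) x₀ X hX h₀
    exact ⟨z, hz, hz'⟩) S hS
  obtain ⟨y, hy, hy', -⟩ := exists_upperBound hK hκ hW x₀ X hX hX₀
  refine ⟨y, hy, fun i hi ⟨y', hyy', hsol⟩ => ?_⟩
  let v := w.symm (fun a => ⟨i a, hi a⟩)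
  have hv : (fun a => (w v a : Ω)) = i := by
    funext a
    simp [v]
  obtain ⟨z, -, -, hz⟩ := hXS v
  have h1 : S v z ≤ y := hz ▸ hy' v
  -- A solution above `y` is also one above the stage `z`, so the problem was solved at step `v`.
  have h2 := hS' v z ⟨y', (hS v z).trans (h1.trans hyy'), hv ▸ hsol⟩
  rw [hv] at h2
  exact h2.mono h1

/-- There is a model of cardinality `κ` solving all solvable extension problems over
its subsets indexed by `A`. -/
theorem exists_closed (hK : K.IsAEC) {θ : Cardinal.{u}} (hθ : ℵ₀ ≤ θ) (hκ : κ = κ ^ θ)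
    (hκ₀ : ℵ₀ ≤ κ) (hA : #A ≤ θ) (x₀ : CModelOf K Ω κ) :
    ∃ y : CModelOf K Ω κ, ∀ i : A → Ω, (∀ a, i a ∈ y.1.carrier) →
      (∃ y' : CModelOf K Ω κ, y ≤ y' ∧ y'.1.Sol C A i) → y.1.Sol C A i := by
  have hθκ : θ < κ := by
    calc θ < 2 ^ θ := cantor θ
      _ ≤ κ ^ θ := power_le_power_right ((natCast_lt_aleph0 (n := 2)).le.trans hκ₀)
      _ = κ := hκ.symm
  have hAκ : κ ^ #A ≤ κ := by
    calc κ ^ #A ≤ κ ^ θ := power_le_power_left (aleph0_pos.trans_le hκ₀).ne' hA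
      _ = κ := hκ.symm
  choose S hS hS' using exists_solution (C := C) (A := A) (Ω := Ω) hK hκ₀ hAκ
  -- With θ⁺ stages, a problem indexed by the set `A` of size at most θ has all its parameters in
  -- one stage, and the next one solves it.
  let W := (Order.succ θ).ord.ToType
  have hW : #W ≤ κ := by
    rw [mk_ord_toType]
    exact Order.succ_le_of_lt hθκ
  have : Nonempty W := by
    rw [← mk_ne_zero_iff, mk_ord_toType]
    exact (zero_le.trans_lt (Order.lt_succ θ)).ne'
  obtain ⟨X, hX, hX₀, hXS⟩ := exists_iteration (W := W) x₀ (fun v X hX h₀ => by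
    obtain ⟨z, hz, hz', -⟩ := exists_upperBound hK hκ₀
      ((mk_le_of_injective Subtype.val_injective).trans hW) x₀ X hX h₀
    exact ⟨z, hz, hz'⟩) (fun _ => S) (fun _ => hS)
  obtain ⟨y, hy, hy', hyU⟩ := exists_upperBound hK hκ₀ hW x₀ X hX hX₀
  refine ⟨y, fun i hi ⟨y', hyy', hsol⟩ => ?_⟩
  choose v hv using fun a => hyU inferInstance _ (hi a)
  obtain ⟨w, hw⟩ : ∃ w : W, ∀ a, v a < w := by
    by_contra! hcon
    have hle : #W ≤ θ := by
      calc #W = #(Set.univ : Set W) := mk_univ.symm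
        _ ≤ #(⋃ a : A, Set.Iic (v a)) := mk_le_mk_of_subset fun w _ => by
          obtain ⟨a, ha⟩ := hcon w
          exact Set.mem_iUnion.2 ⟨a, ha⟩
        _ ≤ Cardinal.sum fun a : A => #(Set.Iic (v a)) := mk_iUnion_le_sum_mk
        _ ≤ Cardinal.sum fun _ : A => θ := Cardinal.sum_le_sum _ _ fun a => by
          rw [← Set.Iio_union_right]
          refine (mk_union_le _ _).trans (add_le_of_le hθ ?_ ?_)
          · exact Order.lt_succ_iff.1 (by simpa [W] using Cardinal.mk_Iio_lt (v a) (by simp [W]))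
          · rw [mk_singleton]
            exact one_le_aleph0.trans hθ
        _ = #A * θ := by simp
        _ ≤ θ * θ := mul_le_mul_left hA θ
        _ = θ := mul_eq_self hθ
    rw [mk_ord_toType] at hle
    exact (Order.lt_succ θ).not_ge hle
  obtain ⟨z, -, hz, hz'⟩ := hXS w
  have h1 : S z ≤ y := hz' ▸ hy' w
  have := hS' z i (fun a => CModel.carrier_subset (hz _ (hw a)) (hv a))
    ⟨y', h1.trans hyy', hsol⟩
  exact this.mono h1

/-- Models of cardinality at least `κ` are rich if `K` is categorical in `κ = κ ^ θ`. -/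
theorem IsAEC.rich_of_categorical (hK : K.IsAEC) {θ : Cardinal.{u}} (hθ : K.LS ≤ θ)
    (hκ : κ = κ ^ θ) (hκ₀ : ℵ₀ ≤ κ) (hcat : (K.restrict {κ}).Categorical)
    {M : Bundled.{u} L.Structure} (hM : κ ≤ #M) : K.Rich θ M := by
  have hθ₀ := hK.aleph0_le_LS.trans hθ
  have hθκ : θ < κ := by
    calc θ < 2 ^ θ := cantor θ
      _ ≤ κ ^ θ := power_le_power_right ((natCast_lt_aleph0 (n := 2)).le.trans hκ₀)
      _ = κ := hκ.symm
  have hLSκ := hθ.trans hθκ.le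
  intro N C f m hf hm hC B h j hj
  let A : Set C := Set.range j
  have hA : #A ≤ θ := (mk_set_le _).trans hC
  -- Size κ⁺ leaves room for every extension of size κ.
  let Ω := (Order.succ κ).out
  have hΩ : #Ω = Order.succ κ := mk_out _
  have hκΩ : κ < #Ω := hΩ ▸ Order.lt_succ κ
  -- a closed model
  obtain ⟨⟨M₁, hM₁⟩, hiso⟩ := hcat
  obtain ⟨⟨j₁, hj₁⟩⟩ : Nonempty (M₁ ↪ Ω) := by
    have : #M₁ ≤ #Ω := hM₁.2.le.trans hκΩ.le
    exact this
  obtain ⟨X, e₁, -⟩ := CModel.exists_equiv hM₁.1 hj₁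
  obtain ⟨y, hy⟩ := exists_closed (C := C) (A := A) hK hθ₀ hκ hκ₀ hA
    (⟨X, (mk_congr e₁.toEquiv).symm.trans hM₁.2⟩ : CModelOf K Ω κ)
  -- a submodel of `M` isomorphic to it
  choose i hi using fun a : A => a.2
  obtain ⟨M₀, k, hk, hBk, hM₀⟩ := hK.exists_submodel_eq (K.mem_dom hf)
    (Set.range fun a => h (i a)) hLSκ (mk_range_le.trans (hA.trans hθκ.le)) hM
  choose i₀ hi₀ using fun a : A => hBk ⟨a, rfl⟩
  obtain ⟨e⟩ := hiso M₀ y.1.toB ⟨K.mem_dom hk, hM₀⟩ ⟨y.1.mem, y.2⟩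
  have heE := K.isEmb_equiv e (K.mem_dom hk)
  have heE' := K.isEmb_equiv e.symm y.1.mem
  have hmi : ∀ a : A, m a = f (k (i₀ a)) := by
    intro a
    rw [hi₀, ← hj, hi]
  -- A hull of `M₀` and `C` of size κ, moved above `y`, solves the problem for `C` over the
  -- transported parameters. Closure of `y` gives a solution in `y`, which is carried back into
  -- `M₀`.
  obtain ⟨N₀, n, hn, hnr, hN₀⟩ := hK.exists_submodel_eq (K.mem_cod hf)
    (Set.range (f.comp k) ∪ Set.range m) hLSκ
    (mk_union_range_le hκ₀ _ _ hM₀.le (hC.trans hθκ.le))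
    (hM.trans (mk_le_of_embedding f))
  obtain ⟨r, hr, hrn⟩ := hK.exists_factor (K.isEmb_comp hk hf) hn
    (fun x => hnr (Or.inl ⟨x, rfl⟩))
  obtain ⟨s, hs, hsn⟩ := hK.exists_factor hm hn (fun x => hnr (Or.inr ⟨x, rfl⟩))
  obtain ⟨Y, d, hXY, hd⟩ := CModel.exists_extension (K.isEmb_comp heE' hr)
    (hκ₀.trans hκΩ.le) (y.2.trans_lt hκΩ) (hN₀.trans_lt hκΩ)
  have hrs : ∀ a : A, s a = r (i₀ a) := by
    intro a
    apply n.injective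
    rw [hsn, hrn, hmi]
    rfl
  obtain ⟨g, hg, hgi⟩ := hy (fun a => CModel.val (e (i₀ a))) (fun a => CModel.val_mem _)
    ⟨⟨Y, (mk_congr d.toEquiv).symm.trans hN₀⟩, hXY, d.toEmbedding.comp s,
      K.isEmb_comp hs (K.isEmb_equiv d (K.mem_cod hs)), fun a => by
        have h₁ := hd (e (i₀ a))
        have h₂ : e.symm.toEmbedding (e (i₀ a)) = i₀ a := e.symm_apply_apply _
        rw [Embedding.comp_apply, h₂] at h₁
        rw [Embedding.comp_apply, hrs]
        exact h₁⟩
  refine ⟨k.comp (e.symm.toEmbedding.comp g), K.isEmb_comp (K.isEmb_comp hg heE') hk, ?_⟩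
  intro b
  let a : A := ⟨j b, b, rfl⟩
  have h1 : g (j b) = e (i₀ a) := CModel.val_injective (hgi a)
  have h2 : h (i a) = h b := by
    apply f.injective
    rw [← hj, ← hj, hi]
  rw [Embedding.comp_apply, Embedding.comp_apply, h1]
  change k (e.symm (e (i₀ a))) = _
  rw [e.symm_apply_apply]
  exact (hi₀ a).trans h2

end Closure

/-! ### Nonsplitting: uniqueness, transitivity and local character -/

variable {μ : Cardinal.{u}}

/-- The hypotheses on `K` below and at the cardinal `μ`. -/
structure Setting (K : AbstractClass L) (μ : Cardinal.{u}) : Prop where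
  isAEC : K.IsAEC
  LS_lt : K.LS < μ
  cof : μ.ord.cof = ℵ₀
  weakAmalgamation : (K.restrict {μ}).WeakAmalgamation
  coherent : (K.restrict (Set.Iio μ)).HasCoherentSequences
  tame : (K.restrict (Set.Iic μ)).Tame K.LS
  categorical : ∀ θ : Cardinal.{u}, ℵ₀ ≤ θ → θ < μ →
    ∃ κ : Cardinal.{u}, ℵ₀ ≤ κ ∧ κ < μ ∧ κ = κ ^ θ ∧ (K.restrict {κ}).Categorical

/-- The type `p` does not split over the family `h`: restrictions of `p` along two embeddings of a
model which agree on preimages of `h` coincide. -/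
def NonSplit (K : AbstractClass L) (μ : Cardinal.{u}) {N : Bundled.{u} L.Structure}
    (p : K.GTp N) {B : Type u} (h : B → N) : Prop :=
  ∀ ⦃C : Bundled.{u} L.Structure⦄ (m m' : C ↪[L] N), K.IsEmb m → K.IsEmb m' → #C ≤ μ →
    ∀ j : B → C, (∀ b, m (j b) = h b) → (∀ b, m' (j b) = h b) →
    p.restrict m.toEmbedding = p.restrict m'.toEmbedding

/-- Enlarging the family weakens the condition, since embeddings that agree over the larger family
agree over the smaller. -/
theorem NonSplit.of_factor {N : Bundled.{u} L.Structure} {p : K.GTp N} {B B' : Type u}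
    {h : B → N} {h' : B' → N} (H : K.NonSplit μ p h) (k : B → B') (hk : ∀ b, h' (k b) = h b) :
    K.NonSplit μ p h' :=
  fun _ m m' hm hm' hC j e e' => H m m' hm hm' hC (fun b => j (k b))
    (fun b => (e _).trans (hk b)) (fun b => (e' _).trans (hk b))

theorem NonSplit.restrict {N M : Bundled.{u} L.Structure} {p : K.GTp N} {B : Type u}
    {t : M ↪[L] N} (ht : K.IsEmb t) {h : B → M} (H : K.NonSplit μ p (fun b => t (h b))) :
    K.NonSplit μ (p.restrict t.toEmbedding) h := by
  intro C m m' hm hm' hC j e e'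
  have := H (t.comp m) (t.comp m') (K.isEmb_comp hm ht) (K.isEmb_comp hm' ht) hC j
    (fun b => congrArg t (e b)) (fun b => congrArg t (e' b))
  rw [GTp.restrict_restrict, GTp.restrict_restrict]
  exact this

namespace Setting

theorem aleph0_le (s : K.Setting μ) : ℵ₀ ≤ μ := s.isAEC.aleph0_le_LS.trans s.LS_lt.le

/-- Raising θ to at least `LS(K)` allows hulls of that size; the matching categoricity cardinal is
still below μ. -/
theorem rich (s : K.Setting μ) {θ : Cardinal.{u}} (hθ : θ < μ) {M : Bundled.{u} L.Structure}
    (hM : μ ≤ #M) : K.Rich θ M := by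
  obtain ⟨κ, h₀, h₁, h₂, h₃⟩ := s.categorical (max θ K.LS)
    (le_max_of_le_right s.isAEC.aleph0_le_LS) (max_lt hθ s.LS_lt)
  exact Rich.mono (s.isAEC.rich_of_categorical (le_max_right _ _) h₂ h₀ h₃ (h₁.le.trans hM))
    (le_max_left _ _)

theorem exists_restrict_ne (s : K.Setting μ) {C : Bundled.{u} L.Structure} (hC : #C ≤ μ)
    {p q : K.GTp C} (hp : p ∈ K.S C) (hq : q ∈ K.S C) (hne : p ≠ q) :
    ∃ A : Set C, #A ≤ K.LS ∧ p.restrict (Function.Embedding.subtype (· ∈ A)) ≠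
      q.restrict (Function.Embedding.subtype (· ∈ A)) := by
  by_contra! h
  exact hne (s.isAEC.eq_of_tame s.LS_lt.le s.tame hC hp hq h)

/-- Nonsplitting need only be tested on small models. -/
theorem nonSplit_of_small (s : K.Setting μ) {N : Bundled.{u} L.Structure} {p : K.GTp N}
    (hp : p ∈ K.S N) {B : Type u} {h : B → N} {κ : Cardinal.{u}} (hκ : K.LS ≤ κ) (hB : #B ≤ κ)
    (H : ∀ ⦃C : Bundled.{u} L.Structure⦄ (m m' : C ↪[L] N), K.IsEmb m → K.IsEmb m' → #C ≤ κ →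
      ∀ j : B → C, (∀ b, m (j b) = h b) → (∀ b, m' (j b) = h b) →
      p.restrict m.toEmbedding = p.restrict m'.toEmbedding) : K.NonSplit μ p h := by
  intro C m m' hm hm' hC j e e'
  by_contra hne
  obtain ⟨A, hA, hne'⟩ := s.exists_restrict_ne hC (restrict_mem_S hm hp) (restrict_mem_S hm' hp) hne
  -- Tameness places the difference on a small set; a small hull of that set and of the family
  -- already shows it.
  obtain ⟨C₀, k, hk, hr, hC₀⟩ := s.isAEC.exists_submodel_le (K.mem_dom hm)
    (Set.range (Subtype.val : A → C) ∪ Set.range j) hκ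
    (mk_union_range_le (s.isAEC.aleph0_le_LS.trans hκ) _ _ (hA.trans hκ) hB)
  choose i hi using fun a : A => hr (Or.inl ⟨a, rfl⟩)
  choose j₀ hj₀ using fun b => hr (Or.inr ⟨b, rfl⟩)
  have := H (m.comp k) (m'.comp k) (K.isEmb_comp hk hm) (K.isEmb_comp hk hm') hC₀ j₀
    (fun b => by rw [Embedding.comp_apply, hj₀, e]) (fun b => by rw [Embedding.comp_apply, hj₀, e'])
  apply hne'
  have hinj : Function.Injective i := fun a a' haa' => Subtype.ext (by rw [← hi a, ← hi a', haa'])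
  have h' := congrArg (fun q => q.restrict (⟨i, hinj⟩ : A ↪ C₀)) this
  simp only [GTp.restrict_restrict] at h' ⊢
  refine (GTp.restrict_congr _ fun a => ?_).trans
    (h'.trans (GTp.restrict_congr _ fun a => ?_))
  · exact congrArg m (hi a).symm
  · exact congrArg m' (hi a)

/-- Uniqueness of nonsplitting extensions. -/
theorem unique (s : K.Setting μ) {M N : Bundled.{u} L.Structure} {f : M ↪[L] N} (hf : K.IsEmb f)
    (hN : #N ≤ μ) {θ : Cardinal.{u}} (hθ : K.LS ≤ θ) (hM : K.Rich θ M) {B : Type u}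
    (hB : #B ≤ θ) (hθμ : θ ≤ μ) {h : B → M} {p q : K.GTp N} (hp : p ∈ K.S N) (hq : q ∈ K.S N)
    (hps : K.NonSplit μ p (fun b => f (h b))) (hqs : K.NonSplit μ q (fun b => f (h b)))
    (hpq : p.restrict f.toEmbedding = q.restrict f.toEmbedding) : p = q := by
  by_contra hne
  obtain ⟨A, hA, hne'⟩ := s.exists_restrict_ne hN hp hq hne
  obtain ⟨C, m, hm, hr, hC⟩ := s.isAEC.exists_submodel_le (K.mem_cod hf)
    (Set.range (Subtype.val : A → N) ∪ Set.range (fun b => f (h b))) hθ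
    (mk_union_range_le (s.isAEC.aleph0_le_LS.trans hθ) _ _ (hA.trans hθ) hB)
  choose i hi using fun a : A => hr (Or.inl ⟨a, rfl⟩)
  choose j hj using fun b => hr (Or.inr ⟨b, rfl⟩)
  -- Richness copies `C` into `M` over the family. By nonsplitting, `p` and `q` each look the same
  -- along `m` and along the copy, and in `M` they agree.
  obtain ⟨g, hg, hgj⟩ := hM f m hf hm hC h j hj
  have h₁ := hps m (f.comp g) hm (K.isEmb_comp hg hf) (hC.trans hθμ) j hj
    (fun b => by rw [Embedding.comp_apply, hgj])
  have h₂ := hqs m (f.comp g) hm (K.isEmb_comp hg hf) (hC.trans hθμ) j hj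
    (fun b => by rw [Embedding.comp_apply, hgj])
  have h₃ : p.restrict (f.comp g).toEmbedding = q.restrict (f.comp g).toEmbedding := by
    have := congrArg (fun r => r.restrict g.toEmbedding) hpq
    simp only [GTp.restrict_restrict] at this
    exact this
  have h₄ : p.restrict m.toEmbedding = q.restrict m.toEmbedding := h₁.trans (h₃.trans h₂.symm)
  have hinj : Function.Injective i := fun a a' haa' => Subtype.ext (by rw [← hi a, ← hi a', haa'])
  have h' := congrArg (fun q => q.restrict (⟨i, hinj⟩ : A ↪ C)) h₄
  simp only [GTp.restrict_restrict] at h'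
  apply hne'
  exact (GTp.restrict_congr _ fun a => (hi a).symm).trans
    (h'.trans (GTp.restrict_congr _ fun a => hi a))

/-- Transitivity of nonsplitting. -/
theorem trans (s : K.Setting μ) {M N : Bundled.{u} L.Structure} {f : M ↪[L] N} (hf : K.IsEmb f)
    {θ : Cardinal.{u}} (hθ : K.LS ≤ θ) (hM : K.Rich θ M) {B₀ B₁ : Type u} (hB₀ : #B₀ ≤ θ)
    (hB₁ : #B₁ ≤ θ) (hθμ : θ ≤ μ) {h₀ : B₀ → M} {h₁ : B₁ → M} {p : K.GTp N} (hp : p ∈ K.S N)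
    (hps : K.NonSplit μ p (fun b => f (h₁ b)))
    (hqs : K.NonSplit μ (p.restrict f.toEmbedding) h₀) :
    K.NonSplit μ p (fun b => f (h₀ b)) := by
  have hθ₀ := s.isAEC.aleph0_le_LS.trans hθ
  refine s.nonSplit_of_small (h := fun b => f (h₀ b)) hp hθ hB₀ ?_
  intro C m m' hm hm' hC j e e'
  obtain ⟨E, k, hk, hr, hE⟩ := s.isAEC.exists_submodel_le (K.mem_cod hf)
    ((Set.range m ∪ Set.range m') ∪
      (Set.range (fun b => f (h₀ b)) ∪ Set.range (fun b => f (h₁ b)))) hθ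
    ((mk_union_le _ _).trans (add_le_of_le hθ₀ (mk_union_range_le hθ₀ _ _ hC hC)
      (mk_union_range_le hθ₀ _ _ hB₀ hB₁)))
  obtain ⟨r, hr₁, hrk⟩ := s.isAEC.exists_factor hm hk (fun x => hr (Or.inl (Or.inl ⟨x, rfl⟩)))
  obtain ⟨r', hr₁', hrk'⟩ := s.isAEC.exists_factor hm' hk
    (fun x => hr (Or.inl (Or.inr ⟨x, rfl⟩)))
  choose j₀ hj₀ using fun b => hr (Or.inr (Or.inl ⟨b, rfl⟩))
  choose j₁ hj₁ using fun b => hr (Or.inr (Or.inr ⟨b, rfl⟩))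
  -- The copy fixes both families: `B₁` so that `p` is unchanged when moved into `M`, and `B₀` so
  -- that `g ∘ r` and `g ∘ r'` test nonsplitting of the restriction to `M`.
  obtain ⟨g, hg, hgj⟩ := hM f k hf hk hE (Sum.elim h₀ h₁) (Sum.elim j₀ j₁) (by
    rintro (b | b)
    · exact hj₀ b
    · exact hj₁ b)
  have key := hps k (f.comp g) hk (K.isEmb_comp hg hf) (hE.trans hθμ) j₁ hj₁
    (fun b => congrArg f (hgj (Sum.inr b)))
  have hrj : ∀ b, r (j b) = j₀ b := fun b => k.injective (by rw [hrk, e, hj₀])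
  have hrj' : ∀ b, r' (j b) = j₀ b := fun b => k.injective (by rw [hrk', e', hj₀])
  have key₂ := hqs (g.comp r) (g.comp r') (K.isEmb_comp hr₁ hg) (K.isEmb_comp hr₁' hg)
    (hC.trans hθμ) j (fun b => by rw [Embedding.comp_apply, hrj]; exact hgj (Sum.inl b))
    (fun b => by rw [Embedding.comp_apply, hrj']; exact hgj (Sum.inl b))
  have k₁ := congrArg (fun q => q.restrict r.toEmbedding) key
  have k₂ := congrArg (fun q => q.restrict r'.toEmbedding) key
  simp only [GTp.restrict_restrict] at k₁ k₂ key₂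
  calc p.restrict m.toEmbedding = p.restrict (r.toEmbedding.trans k.toEmbedding) :=
        GTp.restrict_congr _ fun x => (hrk x).symm
    _ = p.restrict (r.toEmbedding.trans (f.comp g).toEmbedding) := k₁
    _ = p.restrict (r'.toEmbedding.trans (f.comp g).toEmbedding) := key₂
    _ = p.restrict (r'.toEmbedding.trans k.toEmbedding) := k₂.symm
    _ = p.restrict m'.toEmbedding := GTp.restrict_congr _ fun x => hrk' x

/-- Small types over rich models are realized. -/
theorem realize (s : K.Setting μ) {M : Bundled.{u} L.Structure} (hMK : K.Mem M)
    {θ : Cardinal.{u}} (hθ : K.LS ≤ θ) (hM : K.Rich θ M) {X : Type u} (hX : #X ≤ θ) (i : X ↪ M)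
    {p : K.GTp M} (hp : p ∈ K.S M) :
    ∃ c : M, p.restrict i = K.tp hMK i c := by
  obtain ⟨N, f, hf, a, rfl⟩ := hp
  obtain ⟨E, k, hk, hE, hr, e, rfl⟩ := (s.isAEC.shrinks_Iic hθ hX).triple (K.mem_cod hf)
    (i.trans f.toEmbedding) a
  choose j hj using hr
  -- Copying `E` over `X` sends the realization of `p` to an element of `M` with the same type over
  -- `X`.
  obtain ⟨g, hg, hgj⟩ := hM f k hf hk hE i j hj
  have hinj : Function.Injective j := fun x y hxy =>
    (i.trans f.toEmbedding).injective (by rw [← hj x, ← hj y, hxy])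
  refine ⟨g e, ?_⟩
  rw [restrict_tp, ← tp_eq_tp_of_isEmb hk (K.mem_dom hk) _ (i := ⟨j, hinj⟩) hj rfl,
    ← tp_eq_tp_of_isEmb hg (K.mem_dom hk) hMK (i := ⟨j, hinj⟩) hgj rfl]

/-- Local character: a type over a model of cardinality `μ` does not split over some member of any
small covering of the model. -/
theorem localCharacter (s : K.Setting μ) {M : Bundled.{u} L.Structure} (hM : #M = μ) {p : K.GTp M}
    (hp : p ∈ K.S M) {T : Type u} (hT : #T < μ) {B : T → Type u} (h : ∀ t, B t → M)
    (hcov : ∀ c, ∃ t b, h t b = c) : ∃ t, K.NonSplit μ p (h t) := by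
  by_contra hcon
  simp only [NonSplit, not_exists, not_forall] at hcon
  choose C m m' hm hm' hC j e e' hne using hcon
  choose A hA hne' using fun t => s.exists_restrict_ne (hC t) (restrict_mem_S (hm t) hp)
    (restrict_mem_S (hm' t) hp) (hne t)
  let θ := max #T K.LS
  have hθ₀ : ℵ₀ ≤ θ := le_max_of_le_right s.isAEC.aleph0_le_LS
  -- Images of all the witnesses to splitting; this set has size below μ, so `p` is realized over it
  -- by an element of `M`.
  let X : Set M := ⋃ t, (m t '' A t ∪ m' t '' A t)
  have hX : #X ≤ θ := by
    calc #X ≤ Cardinal.sum fun t => #(m t '' A t ∪ m' t '' A t : Set M) := mk_iUnion_le_sum_mk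
      _ ≤ Cardinal.sum fun _ : T => θ := Cardinal.sum_le_sum _ _ fun t =>
        (mk_union_le _ _).trans (add_le_of_le hθ₀ (mk_image_le.trans ((hA t).trans
          (le_max_right _ _))) (mk_image_le.trans ((hA t).trans (le_max_right _ _))))
      _ = #T * θ := by simp
      _ ≤ θ * θ := mul_le_mul_left (le_max_left _ _) θ
      _ = θ := mul_eq_self hθ₀
  have hMK : K.Mem M := by
    obtain ⟨N, f, hf, -⟩ := hp
    exact K.mem_dom hf
  obtain ⟨c, hc⟩ := s.realize hMK (le_max_right _ _) (s.rich (max_lt hT s.LS_lt) hM.ge) hX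
    (Function.Embedding.subtype (· ∈ X)) hp
  -- The realization lies in the family `h t`, so both embeddings of `C t` send `j t b` to it. Both
  -- restrictions to `A t` are then the type of `j t b`, against the choice of `A t`.
  obtain ⟨t, b, rfl⟩ := hcov c
  have key : ∀ (n : C t ↪[L] M), K.IsEmb n → n (j t b) = h t b → (∀ a : A t, n a ∈ X) →
      (p.restrict n.toEmbedding).restrict (Function.Embedding.subtype (· ∈ A t)) =
        K.tp (K.mem_dom (hm t)) (Function.Embedding.subtype (· ∈ A t)) (j t b) := by
    intro n hn hnb hnA
    let i : A t ↪ X := ⟨fun a => ⟨n a, hnA a⟩, fun a a' haa' =>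
      Subtype.ext (n.injective (congrArg Subtype.val haa'))⟩
    have := congrArg (fun q => q.restrict i) hc
    simp only [GTp.restrict_restrict, restrict_tp] at this ⊢
    rw [tp_eq_tp_of_isEmb hn (K.mem_dom (hm t)) hMK (i := Function.Embedding.subtype (· ∈ A t))
      (j := (Function.Embedding.subtype (· ∈ A t)).trans n.toEmbedding) (fun a => rfl) rfl, hnb]
    exact this
  exact hne' t ((key (m t) (hm t) (e t b) fun a =>
      Set.mem_iUnion.2 ⟨t, Or.inl ⟨a, a.2, rfl⟩⟩).trans
    (key (m' t) (hm' t) (e' t b) fun a => Set.mem_iUnion.2 ⟨t, Or.inr ⟨a, a.2, rfl⟩⟩).symm)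

end Setting

/-! ### Filtrations -/

/-- Countably many points are cofinal in μ, and the initial segments they bound have size below μ.
-/
theorem exists_countable_cover (h₀ : ℵ₀ ≤ μ) (hcof : μ.ord.cof = ℵ₀) {X : Type u} (hX : #X = μ) :
    ∃ Λ : ℕ → Set X, (∀ n, #(Λ n) < μ) ∧ ∀ x, ∃ n, x ∈ Λ n := by
  have hX' : #X = #μ.ord.ToType := by rw [hX, mk_ord_toType]
  obtain ⟨e⟩ := Cardinal.eq.1 hX'
  obtain ⟨S, hS, hS'⟩ := Order.exists_cof_eq (α := μ.ord.ToType)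
  rw [Ordinal.cof_toType, hcof] at hS'
  obtain ⟨t⟩ : Nonempty (ULift.{u} ℕ ≃ S) := Cardinal.eq.1 (by rw [hS']; simp)
  refine ⟨fun n => e ⁻¹' (Set.Iic (t ⟨n⟩).1), fun n => ?_, fun x => ?_⟩
  · refine (mk_preimage_of_injective _ _ e.injective).trans_lt ?_
    refine lt_of_le_of_lt (mk_le_mk_of_subset (t := insert (t ⟨n⟩).1 (Set.Iio (t ⟨n⟩).1)) ?_) ?_
    · intro y hy
      exact (le_iff_eq_or_lt.1 hy)
    · exact mk_insert_le.trans_lt (add_lt_of_lt h₀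
        (by simpa using Cardinal.mk_Iio_lt (t ⟨n⟩).1 (by simp)) (one_lt_aleph0.trans_le h₀))
  · obtain ⟨y, hy, hxy⟩ := hS (e x)
    refine ⟨(t.symm ⟨y, hy⟩).down, ?_⟩
    change e x ≤ (t (t.symm ⟨y, hy⟩)).1
    rwa [Equiv.apply_symm_apply]

/-- A countable increasing sequence of models of cardinality less than `μ` with union `N`, each
rich for the cardinality of its predecessor. -/
structure Filtration (K : AbstractClass L) (μ : Cardinal.{u}) (N : Bundled.{u} L.Structure) where
  obj : ℕ → Bundled.{u} L.Structure
  emb : ∀ n, obj n ↪[L] N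
  isEmb : ∀ n, K.IsEmb (emb n)
  LS_le : ∀ n, K.LS ≤ #(obj n)
  mk_lt : ∀ n, #(obj n) < μ
  range_subset : ∀ n, Set.range (emb n) ⊆ Set.range (emb (n + 1))
  rich : ∀ n, K.Rich #(obj n) (obj (n + 1))
  cover : ∀ x, ∃ n, x ∈ Set.range (emb n)

/-- Each next model has size κ = κ^χ with `K` categorical in κ, where χ bounds the previous model
and the current piece of the countable cover; it is therefore rich for χ. -/
theorem Setting.exists_filtration (s : K.Setting μ) {N : Bundled.{u} L.Structure} (hN : K.Mem N)
    (hNμ : #N = μ) {X : Set N} (hX : #X < μ) :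
    ∃ F : K.Filtration μ N, X ⊆ Set.range (F.emb 0) := by
  obtain ⟨Λ, hΛ, hcov⟩ := exists_countable_cover s.aleph0_le s.cof hNμ
  let T := {M : Σ C : Bundled.{u} L.Structure, C ↪[L] N // K.IsEmb M.2 ∧ K.LS ≤ #M.1 ∧ #M.1 < μ}
  have step : ∀ (Y : Set N) (hY : #Y < μ) (x : T), ∃ y : T,
      Set.range x.1.2 ⊆ Set.range y.1.2 ∧ Y ⊆ Set.range y.1.2 ∧ K.Rich #x.1.1 y.1.1 := by
    rintro Y hY ⟨⟨C, f⟩, hf, hC, hC'⟩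
    obtain ⟨κ, h₀, h₁, h₂, h₃⟩ := s.categorical (max #C #Y)
      (le_max_of_le_left (s.isAEC.aleph0_le_LS.trans hC)) (max_lt hC' hY)
    have hκ : max #C #Y ≤ κ := by
      calc max #C #Y ≤ 2 ^ max #C #Y := (cantor _).le
        _ ≤ κ ^ max #C #Y := power_le_power_right ((natCast_lt_aleph0 (n := 2)).le.trans h₀)
        _ = κ := h₂.symm
    obtain ⟨D, g, hg, hr, hD⟩ := s.isAEC.exists_submodel_eq hN (Set.range f ∪ Y) (κ := κ)
      (hC.trans ((le_max_left _ _).trans hκ))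
      ((mk_union_le _ _).trans (add_le_of_le h₀ (mk_range_le.trans ((le_max_left _ _).trans hκ))
        ((le_max_right _ _).trans hκ))) (h₁.le.trans hNμ.ge)
    refine ⟨⟨⟨D, g⟩, hg, ?_, ?_⟩, Set.subset_union_left.trans hr, Set.subset_union_right.trans hr,
      ?_⟩
    · rw [hD]
      exact hC.trans ((le_max_left _ _).trans hκ)
    · rwa [hD]
    · exact Rich.mono (s.isAEC.rich_of_categorical (hC.trans (le_max_left _ _)) h₂ h₀ h₃ hD.ge)
        (le_max_left _ _)
  obtain ⟨C, f, hf, hr, hC⟩ := s.isAEC.exists_submodel_eq hN X (κ := max #X K.LS)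
    (le_max_right _ _) (le_max_left _ _) ((max_lt hX s.LS_lt).le.trans hNμ.ge)
  let x₀ : T := ⟨⟨C, f⟩, hf, by rw [hC]; exact le_max_right _ _, by
    rw [hC]; exact max_lt hX s.LS_lt⟩
  choose S hS₁ hS₂ hS₃ using fun n => step (Λ n) (hΛ n)
  let G : ℕ → T := fun n => Nat.rec x₀ (fun n x => S n x) n
  exact ⟨⟨fun n => (G n).1.1, fun n => (G n).1.2, fun n => (G n).2.1, fun n => (G n).2.2.1,
    fun n => (G n).2.2.2, fun n => hS₁ n (G n), fun n => hS₃ n (G n), fun x => by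
      obtain ⟨n, hn⟩ := hcov x
      exact ⟨n + 1, hS₂ n (G n) hn⟩⟩, hr⟩

namespace Filtration

variable {N : Bundled.{u} L.Structure} (F : K.Filtration μ N)

theorem range_mono : Monotone fun n => Set.range (F.emb n) := monotone_nat_of_le_succ F.range_subset

theorem exists_map (hK : K.IsAEC) {n m : ℕ} (h : n ≤ m) :
    ∃ t : F.obj n ↪[L] F.obj m, K.IsEmb t ∧ ∀ x, F.emb m (t x) = F.emb n x :=
  hK.exists_factor (F.isEmb n) (F.isEmb m) fun x => F.range_mono h ⟨x, rfl⟩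

/-- The inclusions between the members of a filtration. -/
noncomputable def map (hK : K.IsAEC) {n m : ℕ} (h : n ≤ m) : F.obj n ↪[L] F.obj m :=
  (F.exists_map hK h).choose

theorem isEmb_map (hK : K.IsAEC) {n m : ℕ} (h : n ≤ m) : K.IsEmb (F.map hK h) :=
  (F.exists_map hK h).choose_spec.1

theorem emb_map (hK : K.IsAEC) {n m : ℕ} (h : n ≤ m) (x : F.obj n) :
    F.emb m (F.map hK h x) = F.emb n x :=
  (F.exists_map hK h).choose_spec.2 x

/-- A filtration as a chain. -/
noncomputable abbrev system (hK : K.IsAEC) : (K.restrict (Set.Iio μ)).System (ULift.{u} ℕ) where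
  obj i := F.obj i.down
  map h := F.map hK h
  isEmb h := ⟨F.isEmb_map hK h, F.mk_lt _, F.mk_lt _⟩
  map_refl i x := (F.emb _).injective (F.emb_map hK _ _)
  map_map hij hjk x := (F.emb _).injective (by rw [F.emb_map, F.emb_map, F.emb_map])

end Filtration

theorem not_isSuccLimit_uLift_nat (i : ULift.{u} ℕ) : ¬ Order.IsSuccLimit i := by
  obtain ⟨n⟩ := i
  intro h
  cases n with
  | zero => exact h.1 fun j _ => Nat.zero_le j.down
  | succ n =>
    refine h.2 ⟨n⟩ ⟨Nat.lt_succ_self n, fun c h₁ h₂ => ?_⟩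
    have h₁' : n < c.down := h₁
    have h₂' : c.down < n + 1 := h₂
    omega

/-! ### Extension of types, stability and local character along chains -/

namespace Setting

/-- An increasing sequence of types over the members of a filtration has a common extension. -/
theorem exists_type_of_filtration (s : K.Setting μ) {N : Bundled.{u} L.Structure}
    (F : K.Filtration μ N) (q : ∀ n, K.GTp (F.obj n)) (hq : ∀ n, q n ∈ K.S (F.obj n))
    (hqq : ∀ n m (h : n ≤ m), (q m).restrict (F.map s.isAEC h).toEmbedding = q n) :
    ∃ r ∈ K.S N, ∀ n, r.restrict (F.emb n).toEmbedding = q n := by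
  have hsh := fun n => s.isAEC.shrinks_Iio s.LS_lt (F.mk_lt n)
  choose q' hq' hqq' using fun n => (hsh n).exists_ofRestrict_eq s.isAEC (F.mk_lt n) (hq n)
  -- Below ω there are no limit indices, so continuity and locality hold vacuously.
  obtain ⟨N', e, he, a, f, -, -, h₃, h₄, h₅, h₆, h₇, h₈⟩ := s.coherent (ULift.{u} ℕ)
    (F.system s.isAEC) (fun i hi => (not_isSuccLimit_uLift_nat i hi).elim) (fun i => q' i.down)
    ⟨fun i => hq' _, fun i j h => by
      apply (hsh i.down).ofRestrict_injective s.isAEC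
      rw [ofRestrict_restrict, hqq', hqq']
      exact hqq _ _ h⟩
    (fun i hi => (not_isSuccLimit_uLift_nat i hi).elim)
  -- The limit is taken along the maps `f` rather than the inclusions of `N'`: in it all the `a i`
  -- become one element.
  let E : K.System (ULift.{u} ℕ) :=
    { obj := N'.obj
      map := f
      isEmb := fun h => (h₄ _ _ h).1
      map_refl := h₆
      map_map := fun hij hjk x => h₇ _ _ _ hij hjk x }
  let D : K.System (ULift.{u} ℕ) :=
    { obj := (F.system s.isAEC).obj
      map := (F.system s.isAEC).map
      isEmb := fun h => ((F.system s.isAEC).isEmb h).1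
      map_refl := (F.system s.isAEC).map_refl
      map_map := (F.system s.isAEC).map_map }
  obtain ⟨P, g, hg⟩ := E.exists_isUnion
  have hgE : ∀ i, K.IsEmb (g i) := (s.isAEC.union _ E P g hg).2
  have hD : D.IsUnion N (fun i => F.emb i.down) := by
    refine ⟨fun i j h x => F.emb_map s.isAEC (show i.down ≤ j.down from h) x, fun x => ?_⟩
    obtain ⟨n, y, hy⟩ := F.cover x
    exact ⟨⟨n⟩, y, hy⟩
  -- The maps `f` fix the members of the filtration, so their union `N` embeds in the limit.
  obtain ⟨t, ht, htg⟩ := s.isAEC.exists_desc hD (h := fun i => (g i).comp (e i))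
    (fun i => K.isEmb_comp (he i).1 (hgE i)) (fun i j h x => by
      change g j (e j ((F.system s.isAEC).map h x)) = g i (e i x)
      rw [← h₅]
      exact hg.1 i j h _)
  refine ⟨_, tp_mem_S ht (K.mem_cod ht) (g ⟨0⟩ (a ⟨0⟩)), fun n => ?_⟩
  have h0 : g ⟨n⟩ (a ⟨n⟩) = g ⟨0⟩ (a ⟨0⟩) := by
    have := hg.1 ⟨0⟩ ⟨n⟩ (Nat.zero_le n) (a ⟨0⟩)
    rw [← this]
    exact congrArg _ (h₈ _ _ _).symm
  rw [restrict_tp, ← hqq' n, show q' n = _ from h₃ ⟨n⟩, ofRestrict_tp]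
  exact (tp_eq_tp_of_isEmb (hgE ⟨n⟩) _ _ (fun x => (htg ⟨n⟩ x).symm) h0).symm

theorem nonempty_filtration (s : K.Setting μ) {N : Bundled.{u} L.Structure} (hN : K.Mem N)
    (hNμ : #N = μ) : Nonempty (K.Filtration μ N) := by
  obtain ⟨F, -⟩ := s.exists_filtration hN hNμ (X := ∅)
    (by rw [mk_eq_zero]; exact aleph0_pos.trans_le s.aleph0_le)
  exact ⟨F⟩

theorem mk_uLift_nat_lt (s : K.Setting μ) : #(ULift.{u} ℕ) < μ := by
  rw [mk_uLift, mk_nat, lift_aleph0]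
  exact s.isAEC.aleph0_le_LS.trans_lt s.LS_lt

theorem exists_nonSplit_emb (s : K.Setting μ) {N : Bundled.{u} L.Structure} (hN : #N = μ)
    (F : K.Filtration μ N) {p : K.GTp N} (hp : p ∈ K.S N) :
    ∃ n, K.NonSplit μ p (F.emb n) := by
  obtain ⟨⟨k⟩, hk⟩ := s.localCharacter hN hp s.mk_uLift_nat_lt (fun i => F.emb i.down)
    (fun c => by
      obtain ⟨n, b, hb⟩ := F.cover c
      exact ⟨⟨n⟩, b, hb⟩)
  exact ⟨k, hk⟩

/-- A type over a model of cardinality `μ` has a nonsplitting extension to any larger model of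
cardinality `μ`. -/
theorem exists_nonSplit_extension (s : K.Setting μ) {M N : Bundled.{u} L.Structure} {f : M ↪[L] N}
    (hf : K.IsEmb f) (hM : #M = μ) (hN : #N = μ) {p : K.GTp M} (hp : p ∈ K.S M) :
    ∃ q ∈ K.S N, q.restrict f.toEmbedding = p ∧
      (∃ (B : Bundled.{u} L.Structure) (h : B ↪[L] M), K.IsEmb h ∧ K.LS ≤ #B ∧ #B < μ ∧
        K.NonSplit μ q (fun b => f (h b))) ∧
      ∀ b, q.IsEq b → ∃ a, p.IsEq a := by
  obtain ⟨FM⟩ := s.nonempty_filtration (K.mem_dom hf) hM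
  obtain ⟨k, hk⟩ := s.exists_nonSplit_emb hM FM hp
  -- Starting above the member `k + 1`, which is rich for the base `k`, allows the new type to be
  -- compared with `p` there.
  obtain ⟨FN, hFN⟩ := s.exists_filtration (K.mem_cod hf) hN
    (X := Set.range (f.comp (FM.emb (k + 1)))) (mk_range_le.trans_lt (FM.mk_lt _))
  let B := FM.obj k
  let h : B ↪[L] M := FM.emb k
  have hFN' : ∀ n x, f (FM.emb (k + 1) x) ∈ Set.range (FN.emb n) := fun n x =>
    FN.range_mono (Nat.zero_le n) (hFN ⟨x, rfl⟩)
  have hj' : ∀ n (b : B), f (h b) ∈ Set.range (FN.emb n) := fun n b => by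
    have := hFN' n (FM.map s.isAEC (Nat.le_succ k) b)
    rwa [FM.emb_map] at this
  choose j hj using hj'
  -- Each member of the filtration of `N` is copied into `M` over `B`, and `p` is pulled back along
  -- the copy. Different copies agree on `B`, so nonsplitting makes these types increase with `n`.
  have hg' : ∀ n, ∃ g : FN.obj n ↪[L] M, K.IsEmb g ∧ ∀ b, g (j n b) = h b := fun n =>
    s.rich (FN.mk_lt n) hM.ge f (FN.emb n) hf (FN.isEmb n) le_rfl h (j n) (hj n)
  choose g hg hgj using hg'
  obtain ⟨q, hq, hqn⟩ := s.exists_type_of_filtration FN (fun n => p.restrict (g n).toEmbedding)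
    (fun n => restrict_mem_S (hg n) hp) (fun n m hnm => by
      rw [GTp.restrict_restrict]
      refine hk ((g m).comp (FN.map s.isAEC hnm)) (g n)
        (K.isEmb_comp (FN.isEmb_map _ _) (hg m)) (hg n) (FN.mk_lt n).le (j n) (fun b => ?_) (hgj n)
      have : FN.map s.isAEC hnm (j n b) = j m b := (FN.emb m).injective (by
        rw [FN.emb_map, hj, hj])
      rw [Embedding.comp_apply, this, hgj])
  -- Local character gives the base `FN.obj l`. On the next member `q` is a pullback of `p`, hence
  -- does not split over `B`, and transitivity lowers the base to `B`.
  obtain ⟨l, hl⟩ := s.exists_nonSplit_emb hN FN hq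
  have hjinj : ∀ n, Function.Injective (j n) := fun n x y hxy =>
    h.injective (f.injective (by rw [← hj n x, ← hj n y, hxy]))
  have hqs : K.NonSplit μ q (fun b => f (h b)) := by
    have h₁ := s.trans (FN.isEmb (l + 1)) (FN.LS_le l) (FN.rich l)
      (mk_le_of_injective (hjinj l)) le_rfl (FN.mk_lt l).le (h₀ := j (l + 1))
      (h₁ := FN.map s.isAEC (Nat.le_succ l)) hq
      (hl.of_factor id fun b => FN.emb_map _ _ _)
      (by
        rw [hqn]
        exact NonSplit.restrict (hg (l + 1)) (hk.of_factor id fun b => hgj _ b))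
    exact h₁.of_factor id fun b => (hj _ b).symm
  refine ⟨q, hq, ?_, ⟨B, h, FM.isEmb k, FM.LS_le k, FM.mk_lt k, hqs⟩, fun b hb => ?_⟩
  -- Neither `p` nor the restriction of `q` splits over the member `k`, so it is enough to compare
  -- them on the member `k + 1`.
  · refine s.unique (FM.isEmb (k + 1)) hM.le (FM.LS_le k) (FM.rich k) le_rfl (FM.mk_lt k).le
      (h := FM.map s.isAEC (Nat.le_succ k)) (restrict_mem_S hf hq) hp
      ((NonSplit.restrict hf hqs).of_factor id fun b => FM.emb_map _ _ _)
      (hk.of_factor id fun b => FM.emb_map _ _ _) ?_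
    obtain ⟨r, hr, hrf⟩ := s.isAEC.exists_factor (K.isEmb_comp (FM.isEmb (k + 1)) hf) (FN.isEmb 0)
      (fun x => hFN' 0 x)
    calc (q.restrict f.toEmbedding).restrict (FM.emb (k + 1)).toEmbedding
        = q.restrict (r.toEmbedding.trans (FN.emb 0).toEmbedding) := by
          rw [GTp.restrict_restrict]
          exact GTp.restrict_congr _ fun x => (hrf x).symm
      _ = p.restrict ((g 0).comp r).toEmbedding := by
          rw [← GTp.restrict_restrict, hqn, GTp.restrict_restrict]
          rfl
      _ = p.restrict (FM.emb (k + 1)).toEmbedding := by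
          refine hk ((g 0).comp r) (FM.emb (k + 1)) (K.isEmb_comp hr (hg 0)) (FM.isEmb _)
            (FM.mk_lt _).le (FM.map s.isAEC (Nat.le_succ k)) (fun b => ?_)
            (fun b => FM.emb_map _ _ _)
          have : r (FM.map s.isAEC (Nat.le_succ k) b) = j 0 b := (FN.emb 0).injective (by
            rw [hrf, hj, Embedding.comp_apply, FM.emb_map])
          rw [Embedding.comp_apply, this, hgj]
  -- An element of `N` equal to the realization of `q` would have its copy in `M` equal to the
  -- realization of `p`.
  · obtain ⟨n, b', rfl⟩ := FN.cover b
    refine ⟨g n b', ?_⟩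
    have := (isEq_restrict q (FN.emb n).toEmbedding b').2 hb
    rw [hqn] at this
    exact (isEq_restrict p (g n).toEmbedding b').1 this

/-- Stability in `μ`. -/
theorem mk_S_le (s : K.Setting μ) {N : Bundled.{u} L.Structure} (hN : K.Mem N) (hNμ : #N = μ) :
    #(K.S N) ≤ Cardinal.lift.{u + 1} μ := by
  obtain ⟨F⟩ := s.nonempty_filtration hN hNμ
  choose n hn using fun p : K.S N => s.exists_nonSplit_emb hNμ F p.2
  have h₂ : ∀ p : K.S N, ∃ c : N,
      p.1.restrict (F.emb (n p + 1)).toEmbedding = K.tp hN (F.emb (n p + 1)).toEmbedding c :=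
    fun p => s.realize hN (F.LS_le _) (s.rich (F.mk_lt _) hNμ.ge) le_rfl _ p.2
  choose c hc using h₂
  -- The code of a type is the index `n` of a nonsplitting base and an element realizing it over the
  -- member `n + 1`; uniqueness recovers the type.
  have hinj : Function.Injective (fun p : K.S N =>
      (ULift.up (n p, c p) : ULift.{u + 1} (ℕ × N))) := by
    intro p q hpq
    have h := congrArg ULift.down hpq
    have hnpq : n p = n q := congrArg Prod.fst h
    have hcpq : c p = c q := congrArg Prod.snd h
    have hp := hn p
    have hcp := hc p
    rw [hnpq] at hp hcp
    refine Subtype.ext (s.unique (F.isEmb (n q + 1)) hNμ.le (F.LS_le _) (F.rich (n q)) le_rfl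
      (F.mk_lt _).le (h := F.map s.isAEC (Nat.le_succ (n q))) p.2 q.2
      (hp.of_factor id fun b => F.emb_map _ _ _) ((hn q).of_factor id fun b => F.emb_map _ _ _) ?_)
    rw [hcp, hc q, hcpq]
  refine (mk_le_of_injective hinj).trans ?_
  have : #(ULift.{u + 1} (ℕ × N)) = Cardinal.lift.{u + 1} (ℵ₀ * μ) := by
    rw [mk_uLift, mk_prod, mk_nat, hNμ, lift_aleph0, lift_id'.{0, u}]
  rw [this, lift_le]
  exact mul_le_of_le s.aleph0_le s.aleph0_le le_rfl

/-- Local character along chains of models of cardinality `μ`. -/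
theorem chainLocalCharacter (s : K.Setting μ) {I : Type u} [LinearOrder I] {D : K.System I}
    (hD : ∀ i, #(D.obj i) = μ) {M : Bundled.{u} L.Structure} (hMμ : #M = μ)
    {g : ∀ i, D.obj i ↪[L] M} (hg : D.IsUnion M g) (hgE : ∀ i, K.IsEmb (g i)) {p : K.GTp M}
    (hp : p ∈ K.S M) :
    ∃ (i : I) (B : Bundled.{u} L.Structure) (h : B ↪[L] D.obj i), K.IsEmb h ∧ K.LS ≤ #B ∧
      #B < μ ∧ K.NonSplit μ p (fun b => g i (h b)) := by
  have hM : K.Mem M := by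
    obtain ⟨N, f, hf, -⟩ := hp
    exact K.mem_dom hf
  obtain ⟨F⟩ := s.nonempty_filtration hM hMμ
  choose i y hy using hg.2
  -- If every member of the filtration lies inside a member of the chain, a nonsplitting base is
  -- already there. Otherwise fewer than μ indices are cofinal, and filtrations of the corresponding
  -- models together form a small cover.
  by_cases hb : ∀ n, ∃ b, ∀ x : F.obj n, i (F.emb n x) ≤ b
  · choose b hb using hb
    obtain ⟨k, hk⟩ := s.exists_nonSplit_emb hMμ F hp
    obtain ⟨t, ht, htg⟩ := s.isAEC.exists_factor (F.isEmb k) (hgE (b k)) (fun x =>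
      ⟨D.map (hb k x) (y _), by rw [hg.1, hy]⟩)
    exact ⟨b k, F.obj k, t, ht, F.LS_le k, F.mk_lt k, hk.of_factor id htg⟩
  · push Not at hb
    obtain ⟨n, hn⟩ := hb
    let G : ∀ x : F.obj n, K.Filtration μ (D.obj (i (F.emb n x))) := fun x =>
      (s.nonempty_filtration (K.mem_dom (hgE _)) (hD _)).some
    obtain ⟨⟨x, ⟨k⟩⟩, hk⟩ := s.localCharacter hMμ hp (T := F.obj n × ULift.{u} ℕ)
      (by
        rw [mk_prod, lift_id, lift_id]
        exact mul_lt_of_lt s.aleph0_le (F.mk_lt n) s.mk_uLift_nat_lt)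
      (fun t => (g _).comp ((G t.1).emb t.2.down)) (fun c => by
        obtain ⟨x, hx⟩ := hn (i c)
        obtain ⟨k, z, hz⟩ := (G x).cover (D.map hx.le (y c))
        refine ⟨(x, ⟨k⟩), z, ?_⟩
        rw [Embedding.comp_apply]
        change g _ ((G x).emb k z) = c
        rw [hz, hg.1, hy])
    exact ⟨_, _, (G x).emb k, (G x).isEmb k, (G x).LS_le k, (G x).mk_lt k, hk⟩

end Setting

/-! ### Amalgamation in `μ` -/

/-- A partial amalgam: a `K`-embedding into a model on a subset of `Ω`, defined on a `K`-submodel of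
`N`, where both models have cardinality `μ`. -/
structure PartialAmalgam (K : AbstractClass L) (μ : Cardinal.{u}) (N : Bundled.{u} L.Structure)
    (Ω : Type u) where
  dom : CModel K N
  cod : CModel K Ω
  mk_dom : #dom.toB = μ
  mk_cod : #cod.toB = μ
  sub : ∃ e : dom.toB ↪[L] N, K.IsEmb e ∧ ∀ x, e x = CModel.val x
  map : dom.toB ↪[L] cod.toB
  isEmb : K.IsEmb map

namespace PartialAmalgam

variable {N : Bundled.{u} L.Structure} {Ω : Type u}

instance : Preorder (PartialAmalgam K μ N Ω) where
  le X Y := ∃ (h : X.dom ≤ Y.dom), X.cod ≤ Y.cod ∧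
    ∀ x, CModel.val (Y.map (CModel.incl h x)) = CModel.val (X.map x)
  le_refl X := ⟨le_rfl, le_rfl, fun x => by
    rw [show CModel.incl le_rfl x = x from CModel.val_injective (CModel.val_incl _ _)]⟩
  le_trans X Y Z := fun ⟨h, h', e⟩ ⟨k, k', f⟩ => ⟨h.trans k, h'.trans k', fun x => by
    rw [← e, ← f]
    congr 2
    apply CModel.val_injective
    rw [CModel.val_incl, CModel.val_incl, CModel.val_incl]⟩

/-- Domains, codomains and maps are united separately; at most μ stages keep both sizes equal to μ.
-/
theorem exists_upperBound (hK : K.IsAEC) (hμ : ℵ₀ ≤ μ) {I : Type u} [LinearOrder I] (hI : #I ≤ μ)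
    (x₀ : PartialAmalgam K μ N Ω) (X : I → PartialAmalgam K μ N Ω) (hX : Monotone X)
    (h₀ : ∀ i, x₀ ≤ X i) : ∃ z, x₀ ≤ z ∧ ∀ i, X i ≤ z := by
  rcases isEmpty_or_nonempty I with h | h
  · exact ⟨x₀, le_rfl, fun i => isEmptyElim i⟩
  have hXd : Monotone fun i => (X i).dom := fun i j hij => (hX hij).1
  have hXc : Monotone fun i => (X i).cod := fun i j hij => (hX hij).2.1
  obtain ⟨Y, hY, hYU, hYu⟩ := CModel.exists_union hK hXd
  obtain ⟨Z, hZ, hZU, hZu⟩ := CModel.exists_union hK hXc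
  have i₀ := Classical.arbitrary I
  have hYμ : #Y.toB = μ := by
    refine le_antisymm (CModel.mk_union_le hYU hμ hI fun i => (X i).mk_dom.le) ?_
    rw [← (X i₀).mk_dom]
    exact mk_le_of_embedding (CModel.incl (hY i₀))
  have hZμ : #Z.toB = μ := by
    refine le_antisymm (CModel.mk_union_le hZU hμ hI fun i => (X i).mk_cod.le) ?_
    rw [← (X i₀).mk_cod]
    exact mk_le_of_embedding (CModel.incl (hZ i₀))
  choose e he hev using fun i => (X i).sub
  obtain ⟨t, ht, hte⟩ := hK.exists_desc hYu he (fun i j hij x => by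
    rw [hev, hev, CModel.val_incl])
  obtain ⟨φ, hφ, hφX⟩ := hK.exists_desc hYu (h := fun i => (CModel.incl (hZ i)).comp (X i).map)
    (fun i => K.isEmb_comp (X i).isEmb (CModel.isEmb_incl _)) (fun i j hij x => by
      apply CModel.val_injective
      rw [Embedding.comp_apply, Embedding.comp_apply, CModel.val_incl, CModel.val_incl]
      exact (hX hij).2.2 x)
  let z : PartialAmalgam K μ N Ω := ⟨Y, Z, hYμ, hZμ, ⟨t, ht, fun y => by
    obtain ⟨i, x, rfl⟩ := hYu.2 y
    rw [hte, hev, CModel.val_incl]⟩, φ, hφ⟩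
  have hz : ∀ i, X i ≤ z := fun i => ⟨hY i, hZ i, fun x => by
    change CModel.val (φ _) = _
    rw [hφX, Embedding.comp_apply, CModel.val_incl]⟩
  exact ⟨z, (h₀ i₀).trans (hz i₀), hz⟩

/-- The type of `a` over the domain extends, along the map, to a type over the codomain. Once this
is realized, weak amalgamation extends the map to a submodel of `N` containing `a`. -/
theorem exists_step (s : K.Setting μ) (hN : #N = μ) (hΩ : μ < #Ω) (X : PartialAmalgam K μ N Ω)
    (a : N) : ∃ Y, X ≤ Y ∧ a ∈ Y.dom.carrier := by
  obtain ⟨e, he, hev⟩ := X.sub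
  obtain ⟨q, hq, hqp, -⟩ := s.exists_nonSplit_extension X.isEmb X.mk_dom X.mk_cod
    (tp_mem_S he (K.mem_cod he) a)
  obtain ⟨Q, g, hg, b, rfl⟩ := hq
  obtain ⟨Q', k, hk, hQ', hr, b', rfl⟩ := (s.isAEC.shrinks_singleton s.LS_lt.le X.mk_cod).triple
    (K.mem_cod hg) g.toEmbedding b
  obtain ⟨r, hr, hrk⟩ := s.isAEC.exists_factor hg hk hr
  have htp : K.tp (K.mem_cod he) e.toEmbedding a =
      K.tp (K.mem_cod (K.isEmb_comp X.isEmb hr)) (r.comp X.map).toEmbedding b' := by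
    rw [← hqp]
    exact (tp_eq_tp_of_isEmb hk (K.mem_dom hk) (K.mem_cod hk) (i := (r.comp X.map).toEmbedding)
      (j := (g.comp X.map).toEmbedding) (fun x => hrk _) rfl).symm
  obtain ⟨P₁, N₂, j, k', l, f, hj, hk', hl, hf, hP₁, hN₂, hkj, ⟨c, hc⟩, hfl⟩ :=
    s.isAEC.weakAmalgamation s.LS_lt.le s.weakAmalgamation he (K.isEmb_comp X.isEmb hr)
      X.mk_dom hN hQ' htp
  obtain ⟨Y, E, hE⟩ := CModel.exists_equiv (K.mem_dom hk') k'.injective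
  have hEe := K.isEmb_equiv E (K.mem_dom hk')
  have hEs := K.isEmb_equiv E.symm (K.mem_cod hEe)
  obtain ⟨Z, G, hZ, hG⟩ := CModel.exists_extension (K.isEmb_comp hr hl)
    (s.aleph0_le.trans hΩ.le) (X.mk_cod.trans_lt hΩ) (hN₂.trans_lt hΩ)
  have hXY : X.dom ≤ Y := ⟨E.toEmbedding.comp j, K.isEmb_comp hj hEe, fun x => by
    rw [Embedding.comp_apply]
    exact (hE _).trans ((hkj x).trans (hev x))⟩
  have hincl : ∀ x, CModel.incl hXY x = E (j x) := fun x => CModel.val_injective (by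
    rw [CModel.val_incl, hE, hkj, hev])
  refine ⟨⟨Y, Z, ?_, ?_, ⟨k'.comp E.symm.toEmbedding, K.isEmb_comp hEs hk', fun y => ?_⟩,
    (G.toEmbedding.comp f).comp E.symm.toEmbedding,
    K.isEmb_comp hEs (K.isEmb_comp hf (K.isEmb_equiv G (K.mem_cod hf)))⟩,
    ⟨hXY, hZ, fun x => ?_⟩, ?_⟩
  · rw [← hP₁]
    exact (mk_congr E.toEquiv).symm
  · rw [← hN₂]
    exact (mk_congr G.toEquiv).symm
  · obtain ⟨x, rfl⟩ := E.surjective y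
    rw [hE, Embedding.comp_apply]
    exact congrArg k' (E.symm_apply_apply x)
  · change CModel.val (G (f (E.symm (CModel.incl hXY x)))) = _
    rw [hincl, E.symm_apply_apply, hfl]
    exact hG _
  · rw [← hc, ← hE]
    exact CModel.val_mem _

end PartialAmalgam

/-- Amalgamation in `μ`. -/
theorem Setting.amalgamation (s : K.Setting μ) {M₀ M₁ M₂ : Bundled.{u} L.Structure}
    {f₁ : M₀ ↪[L] M₁} {f₂ : M₀ ↪[L] M₂} (h₁ : K.IsEmb f₁) (h₂ : K.IsEmb f₂) (hM₀ : #M₀ = μ)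
    (hM₁ : #M₁ = μ) (hM₂ : #M₂ = μ) :
    ∃ (M₃ : Bundled.{u} L.Structure) (g₁ : M₁ ↪[L] M₃) (g₂ : M₂ ↪[L] M₃),
      K.IsEmb g₁ ∧ K.IsEmb g₂ ∧ #M₃ = μ ∧ ∀ x, g₁ (f₁ x) = g₂ (f₂ x) := by
  let Ω := (Order.succ μ).ord.ToType
  have hΩ : μ < #Ω := by
    rw [mk_ord_toType]
    exact Order.lt_succ μ
  obtain ⟨j⟩ : Nonempty (M₂ ↪ Ω) := hM₂.trans_le hΩ.le
  obtain ⟨P, E, hE⟩ := CModel.exists_equiv (K.mem_dom h₁) f₁.injective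
  obtain ⟨Q, G, hG⟩ := CModel.exists_equiv (K.mem_dom (isEmb_refl (K.mem_cod h₂))) j.injective
  have hGe := K.isEmb_equiv G (K.mem_cod h₂)
  have hEs := K.isEmb_equiv E.symm (K.mem_cod (K.isEmb_equiv E (K.mem_dom h₁)))
  let x₀ : PartialAmalgam K μ M₁ Ω := ⟨P, Q, hM₀ ▸ (mk_congr E.toEquiv).symm,
    hM₂ ▸ (mk_congr G.toEquiv).symm, ⟨f₁.comp E.symm.toEmbedding, K.isEmb_comp hEs h₁, fun y => by
      obtain ⟨x, rfl⟩ := E.surjective y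
      rw [hE, Embedding.comp_apply]
      exact congrArg f₁ (E.symm_apply_apply x)⟩,
    (G.toEmbedding.comp f₂).comp E.symm.toEmbedding, K.isEmb_comp hEs (K.isEmb_comp h₂ hGe)⟩
  -- One step for each element of `M₁`, so that the final domain is all of `M₁`.
  let W := μ.ord.ToType
  have hW : #W = μ := mk_ord_toType μ
  obtain ⟨w⟩ : Nonempty (W ≃ M₁) := Cardinal.eq.1 (hW.trans hM₁.symm)
  choose S hS hS' using fun (v : W) (X : PartialAmalgam K μ M₁ Ω) =>
    PartialAmalgam.exists_step s hM₁ hΩ X (w v)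
  obtain ⟨X, hX, hX₀, hXS⟩ := exists_iteration x₀ (fun v X hX h₀ =>
    PartialAmalgam.exists_upperBound s.isAEC s.aleph0_le ((mk_subtype_le _).trans hW.le) x₀ X hX h₀)
    S hS
  obtain ⟨z, hz, hXz⟩ := PartialAmalgam.exists_upperBound s.isAEC s.aleph0_le hW.le x₀ X hX hX₀
  obtain ⟨e, he, hev⟩ := z.sub
  obtain ⟨t, ht, hte⟩ := s.isAEC.exists_factor (isEmb_refl (K.mem_cod h₁)) he (fun a => by
    obtain ⟨v, rfl⟩ := w.surjective a
    obtain ⟨y, -, -, hy⟩ := hXS v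
    have h := hS' v y
    rw [← hy] at h
    obtain ⟨c, hc⟩ := CModel.exists_val_eq (CModel.carrier_subset (hXz v).1 h)
    exact ⟨c, by rw [hev, hc]; rfl⟩)
  refine ⟨z.cod.toB, z.map.comp t, (CModel.incl hz.2.1).comp G.toEmbedding, K.isEmb_comp ht z.isEmb,
    K.isEmb_comp hGe (CModel.isEmb_incl _), z.mk_cod, fun x => CModel.val_injective ?_⟩
  have h : t (f₁ x) = CModel.incl hz.1 (E x) := CModel.val_injective (by
    rw [CModel.val_incl, hE, ← hev]
    exact hte _)
  rw [Embedding.comp_apply, h, hz.2.2]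
  change CModel.val (G (f₂ (E.symm (E x)))) = CModel.val (CModel.incl hz.2.1 (G (f₂ x)))
  rw [E.symm_apply_apply]
  exact (CModel.val_incl hz.2.1 _).symm

/-! ### Models above a given model -/

section Above

variable {M : Bundled.{u} L.Structure}

/-- The expansion of `Q` by constants for the elements of `M`. -/
def expand {Q : Bundled.{u} L.Structure} (h : M ↪[L] Q) : Bundled.{u} L[[M]].Structure :=
  ⟨Q, letI := constantsOn.structure (M := Q) h; inferInstanceAs (L[[M]].Structure Q)⟩

/-- An embedding of reducts preserving the constants. -/
def liftEmb {N N' : Bundled.{u} L[[M]].Structure} (f : red N ↪[L] red N')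
    (hf : ∀ m, f (constVal N m) = constVal N' m) : N ↪[L[[M]]] N' where
  toEmbedding := f.toEmbedding
  map_fun' {n} F x := by
    rcases F with F | F
    · exact f.map_fun' F x
    · cases n with
      | zero =>
        rw [Subsingleton.elim x default, Subsingleton.elim (_ ∘ _) default]
        exact hf F
      | succ n => exact F.elim
  map_rel' {n} R x := by
    rcases R with R | R
    · exact f.map_rel' R x
    · exact R.elim

theorem redEmb_constVal {N N' : Bundled.{u} L[[M]].Structure} (f : N ↪[L[[M]]] N') (m : M) :
    redEmb f (constVal N m) = constVal N' m :=
  HomClass.map_constants f (L.con m)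

theorem AboveMem.mem_red {N : Bundled.{u} L[[M]].Structure} (h : K.AboveMem M N) :
    K.Mem (red N) := by
  obtain ⟨f, hf, -⟩ := h
  exact K.mem_cod hf

theorem aboveMem_expand {Q : Bundled.{u} L.Structure} {h : M ↪[L] Q} (hh : K.IsEmb h) :
    K.AboveMem M (expand h) := ⟨h, hh, fun _ => rfl⟩

theorem AboveMem.exists_lift {N : Bundled.{u} L[[M]].Structure} (hN : K.AboveMem M N)
    {Q : Bundled.{u} L.Structure} {f : red N ↪[L] Q} (hf : K.IsEmb f) :
    ∃ (c : M ↪[L] Q) (f' : N ↪[L[[M]]] expand c), (K.above M).IsEmb f' ∧ redEmb f' = f ∧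
      ∀ m, c m = f (constVal N m) := by
  obtain ⟨c, hc, hcN⟩ := hN
  have h := aboveMem_expand (K.isEmb_comp hc hf)
  exact ⟨f.comp c, liftEmb (N' := expand (f.comp c)) f (fun m => congrArg f (hcN m).symm),
    ⟨⟨c, hc, hcN⟩, h, hf⟩, rfl, fun m => congrArg f (hcN m)⟩

/-- The reduct of a system. -/
def redSystem {I : Type u} [Preorder I] (D : (K.above M).System I) : K.System I where
  obj i := red (D.obj i)
  map h := redEmb (D.map h)
  isEmb h := (D.isEmb h).2.2
  map_refl := D.map_refl
  map_map := D.map_map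

/-- Hulls must also contain the constants, at a cost of at most μ elements. -/
theorem isLSNumber_above (hK : K.IsAEC) (hμ : K.LS ≤ μ) (hM : #M ≤ μ) :
    (K.above M).IsLSNumber μ := by
  have h₀ := hK.aleph0_le_LS.trans hμ
  refine ⟨?_, fun N hN A => ?_⟩
  · rw [Language.card_withConstants, lift_id, lift_id]
    exact add_le_of_le h₀ (add_le_of_le h₀ ((le_self_add.trans hK.isLSNumber.1).trans hμ) hM) h₀
  · obtain ⟨c, hc, hcN⟩ := hN
    obtain ⟨P, f, hf, hr, hP⟩ := hK.exists_submodel_le (K.mem_cod hc) (A ∪ Set.range c)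
      (κ := #A + μ) (hμ.trans le_add_self) ((mk_union_le _ _).trans
        (add_le_add le_rfl (mk_range_le.trans hM)))
    obtain ⟨r, hr', hrf⟩ := hK.exists_factor hc hf (fun x => hr (Or.inr ⟨x, rfl⟩))
    exact ⟨expand r, liftEmb (N := expand r) f (fun m => (hrf m).trans (hcN m)),
      ⟨aboveMem_expand hr', ⟨c, hc, hcN⟩, hf⟩, Set.subset_union_left.trans hr, hP⟩

theorem isAEC_above (hK : K.IsAEC) (M : Bundled.{u} L.Structure) : (K.above M).IsAEC where
  coherence {M₀ M₁ M₂} f g h₁ hg hgf := ⟨hgf.1, h₁, hK.isEmb_of_comp hg.2.2 hgf.2.2⟩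
  union I _ _ _ D N g hg := by
    have h := (hK.union I (redSystem D) (red N) (fun i => redEmb (g i)) hg).2
    have i := Classical.arbitrary I
    have hD := fun i => K.above M |>.mem_dom (D.isEmb (le_refl i))
    have hN : K.AboveMem M N := (hD i).of_emb (g i) (h i)
    exact ⟨hN, fun i => ⟨hD i, hN, h i⟩⟩
  union_le I _ _ _ D N g hg P k hP hk := by
    have h := (hK.union I (redSystem D) (red N) (fun i => redEmb (g i)) hg).2
    have i := Classical.arbitrary I
    have hD := fun i => K.above M |>.mem_dom (D.isEmb (le_refl i))
    exact ⟨(hD i).of_emb (g i) (h i), hP,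
      hK.union_le I (redSystem D) (red N) (fun i => redEmb (g i)) hg (red P) (redEmb k)
        (AboveMem.mem_red hP) (fun i => (hk i).2.2)⟩
  lowenheimSkolemTarski := ⟨_, isLSNumber_above hK (le_max_left _ #M) (le_max_right _ _)⟩

/-- The reduct of a type. -/
def GTp.red {A : Type u} (p : (K.above M).GTp A) : K.GTp A :=
  Quot.map (fun t : (K.above M).Triple A =>
      (⟨AbstractClass.red t.model, t.mem.mem_red, t.incl, t.elt⟩ : K.Triple A))
    (fun _ _ ⟨N, f, g, hf, hg, h, hb⟩ =>
      ⟨AbstractClass.red N, redEmb f, redEmb g, hf.2.2, hg.2.2, h, hb⟩) p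

theorem red_restrict {A B : Type u} (p : (K.above M).GTp A) (g : B ↪ A) :
    (p.restrict g).red = p.red.restrict g := by
  induction p using Quot.ind
  rfl

theorem isEq_red {A : Type u} (p : (K.above M).GTp A) (x : A) : p.red.IsEq x ↔ p.IsEq x := by
  induction p using Quot.ind
  rfl

theorem red_mem_S {N : Bundled.{u} L[[M]].Structure} {p : (K.above M).GTp N}
    (hp : p ∈ (K.above M).S N) : p.red ∈ K.S (red N) := by
  obtain ⟨N', f, hf, b, rfl⟩ := hp
  exact ⟨red N', redEmb f, hf.2.2, b, rfl⟩

theorem AboveMem.exists_red_eq {N : Bundled.{u} L[[M]].Structure} (hN : K.AboveMem M N)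
    {p : K.GTp (red N)} (hp : p ∈ K.S (red N)) : ∃ q ∈ (K.above M).S N, q.red = p := by
  obtain ⟨Q, f, hf, b, rfl⟩ := hp
  obtain ⟨c, f', hf', rfl, -⟩ := hN.exists_lift hf
  exact ⟨_, ⟨_, f', hf', b, rfl⟩, rfl⟩

/-- The triple `t` is the reduct of a triple in `K_M` in which `k m` is the constant for `m`. -/
def Triple.Expands {A : Type u} (k : M → A) (t : K.Triple A) : Prop :=
  ∃ c : M ↪[L] t.model, K.IsEmb c ∧ ∀ m, c m = t.incl (k m)

/-- Coherence carries the `K`-submodel of parameters across a common extension. Expandability is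
thus an invariant of the type, although the triples linking two representatives are only triples
over a set. -/
theorem Triple.Expands.of_eAt (hK : K.IsAEC) {A : Type u} {k : M → A} {t t' : K.Triple A}
    (h : t.Expands k) (htt' : K.EAt t t') : t'.Expands k := by
  obtain ⟨c, hc, hck⟩ := h
  obtain ⟨N, f, g, hf, hg, hfg, -⟩ := htt'
  obtain ⟨c', hc', hcc'⟩ := hK.exists_factor (K.isEmb_comp hc hf) hg (fun m =>
    ⟨t'.incl (k m), by rw [← hfg, Embedding.comp_apply, hck]⟩)
  exact ⟨c', hc', fun m => g.injective (by rw [hcc', ← hfg, Embedding.comp_apply, hck])⟩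

theorem EAt.symm {A : Type u} {t t' : K.Triple A} (h : K.EAt t t') : K.EAt t' t := by
  obtain ⟨N, f, g, hf, hg, hfg, hb⟩ := h
  exact ⟨N, g, f, hg, hf, fun a => (hfg a).symm, hb.symm⟩

/-- The expansion of a triple. -/
noncomputable def Triple.Expands.triple {A : Type u} {k : M → A} {t : K.Triple A}
    (h : t.Expands k) : (K.above M).Triple A :=
  ⟨expand h.choose, aboveMem_expand h.choose_spec.1, t.incl, t.elt⟩

theorem Triple.Expands.eAt {A : Type u} {k : M → A} {t t' : K.Triple A} (h : t.Expands k)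
    (h' : t'.Expands k) (htt' : K.EAt t t') : (K.above M).EAt h.triple h'.triple := by
  obtain ⟨N, f, g, hf, hg, hfg, hb⟩ := htt'
  have hc := h.choose_spec
  have hc' := h'.choose_spec
  have hN : K.AboveMem M (expand (f.comp h.choose)) := aboveMem_expand (K.isEmb_comp hc.1 hf)
  exact ⟨expand (f.comp h.choose), liftEmb (N := expand h.choose) (N' := expand (f.comp h.choose)) f
      (fun m => rfl),
    liftEmb (N := expand h'.choose) (N' := expand (f.comp h.choose)) g (fun m => by
      change g (h'.choose m) = f (h.choose m)
      rw [hc.2, hc'.2, hfg]),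
    ⟨aboveMem_expand hc.1, hN, hf⟩, ⟨aboveMem_expand hc'.1, hN, hg⟩, hfg, hb⟩

/-- Expanding a representative gives a left inverse of the reduct. The value `none` is used for
triples without an expansion, which do not occur for types in `S(N)`. -/
theorem red_injOn (hK : K.IsAEC) (N : Bundled.{u} L[[M]].Structure) :
    Set.InjOn (GTp.red : (K.above M).GTp N → K.GTp N) ((K.above M).S N) := by
  classical
  let k : M → N := constVal N
  let back : K.GTp N → Option ((K.above M).GTp N) :=
    Quot.lift (fun t => if h : t.Expands k then some (Quot.mk _ h.triple) else none)
      (fun t t' htt' => by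
        by_cases h : t.Expands k
        · have h' := h.of_eAt hK htt'
          rw [dif_pos h, dif_pos h']
          exact congrArg some (Quot.sound (h.eAt h' htt'))
        · have h' : ¬ t'.Expands k := fun h' => h (h'.of_eAt hK htt'.symm)
          rw [dif_neg h, dif_neg h'])
  have hback : ∀ p ∈ (K.above M).S N, back p.red = some p := by
    rintro p ⟨P, f, hf, b, rfl⟩
    obtain ⟨c, hc, hcP⟩ := hf.2.1
    have h : Triple.Expands k (⟨red P, hf.2.1.mem_red, f.toEmbedding, b⟩ : K.Triple N) :=
      ⟨c, hc, fun m => (hcP m).trans (redEmb_constVal f m).symm⟩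
    have e : back ((K.above M).tp ((K.above M).mem_cod hf) f.toEmbedding b).red =
      some (Quot.mk _ h.triple) := dif_pos h
    rw [e]
    refine congrArg some (Quot.sound ⟨P, liftEmb (N := expand h.choose) (Embedding.refl L (red P))
      (fun m => ?_), Embedding.refl _ P, ⟨aboveMem_expand h.choose_spec.1, hf.2.1,
        isEmb_refl (K.mem_cod hc)⟩, isEmb_refl (K := K.above M) hf.2.1, fun _ => rfl, rfl⟩)
    exact (h.choose_spec.2 m).trans (redEmb_constVal f m)
  intro p hp q hq hpq
  have h := congrArg back hpq
  rw [hback p hp, hback q hq] at h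
  exact Option.some.inj h

theorem red_mem_Sna {N : Bundled.{u} L[[M]].Structure} {p : (K.above M).GTp N}
    (hp : p ∈ (K.above M).Sna N) : p.red ∈ K.S (red N) ∧ ∀ x, ¬ p.red.IsEq x :=
  ⟨red_mem_S hp.1, fun x hx => hp.2 ((isAlgebraic_iff hp.1).2 ⟨x, (isEq_red p x).1 hx⟩)⟩

end Above

/-! ### Nonsplitting over small submodels -/

namespace Setting

/-- An isomorphism of two submodels over a set amounts to two embeddings of one model agreeing on
that set. The size bound in `Splits` is here `#B`, and `nonSplit_of_small` raises it to μ. -/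
theorem nonsplittingOverSmall_iff (s : K.Setting μ) {N₀ N₁ : Bundled.{u} L.Structure}
    {f : N₀ ↪[L] N₁} {p : K.GTp N₁} (hp : p ∈ K.S N₁) :
    K.NonsplittingOverSmall μ f p ↔ ∃ (B : Bundled.{u} L.Structure) (h : B ↪[L] N₀),
      K.IsEmb h ∧ K.LS ≤ #B ∧ #B < μ ∧ K.NonSplit μ p (fun b => f (h b)) := by
  unfold NonsplittingOverSmall
  refine exists_congr fun B => exists_congr fun h => and_congr_right fun _ =>
    and_congr_right fun hB => and_congr_right fun hBμ => ?_
  have hB₀ := s.isAEC.aleph0_le_LS.trans hB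
  have hr : #(Set.range (f.comp h)) = #B := mk_range_eq _ (f.comp h).injective
  have hr' : #(Set.range (f.comp h)) + ℵ₀ = #B := by rw [hr, add_eq_left hB₀ hB₀]
  unfold Splits
  rw [hr']
  constructor
  · intro hs
    refine s.nonSplit_of_small hp hB le_rfl fun C m m' hm hm' hC j e e' => ?_
    by_contra hne
    refine hs ⟨C, C, m, m', Language.Equiv.refl L C, hm, hm', Order.lt_succ_of_le hC,
      Order.lt_succ_of_le hC, ?_, ?_, ?_, fun h' => hne ?_⟩
    · rintro _ ⟨b, rfl⟩
      exact ⟨j b, e b⟩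
    · rintro _ ⟨b, rfl⟩
      exact ⟨j b, e' b⟩
    · rintro x ⟨b, hb⟩
      have : x = j b := m.injective (by rw [e, ← hb]; rfl)
      change m' x = m x
      rw [this, e, e']
    · rw [GTp.restrict_restrict] at h'
      exact h'
  · rintro hs ⟨M₁, M₂, m₁, m₂, e, hm₁, hm₂, -, hM₂, hA₁, hA₂, hfix, hne⟩
    refine hne ?_
    choose j hj using fun b => hA₂ ⟨b, rfl⟩
    rw [GTp.restrict_restrict]
    refine hs (m₁.comp e.symm.toEmbedding) m₂
      (K.isEmb_comp (K.isEmb_equiv e.symm (K.mem_dom hm₂)) hm₁) hm₂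
      ((Order.lt_succ_iff.1 hM₂).trans hBμ.le) j (fun b => ?_) hj
    obtain ⟨x, hx⟩ := hA₁ ⟨b, rfl⟩
    have h₁ : e x = j b := m₂.injective (by
      rw [hfix x (hx ▸ ⟨b, rfl⟩), hx, hj])
    rw [← h₁]
    exact (congrArg m₁ (e.symm_apply_apply x)).trans hx

/-- Monotonicity and invariance of nonsplitting over small submodels. -/
theorem nonsplittingOverSmall_restrict (s : K.Setting μ) {N₀ N₁ N₀' N₁' : Bundled.{u} L.Structure}
    {f : N₀ ↪[L] N₁} {f' : N₀' ↪[L] N₁'} {r : N₀ ↪[L] N₀'} {t : N₁' ↪[L] N₁} (hr : K.IsEmb r)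
    (ht : K.IsEmb t) (hf : ∀ x, t (f' (r x)) = f x) {p : K.GTp N₁} (hp : p ∈ K.S N₁)
    (h : K.NonsplittingOverSmall μ f p) :
    K.NonsplittingOverSmall μ f' (p.restrict t.toEmbedding) := by
  rw [s.nonsplittingOverSmall_iff hp] at h
  rw [s.nonsplittingOverSmall_iff (restrict_mem_S ht hp)]
  obtain ⟨B, h, hh, hB, hBμ, hs⟩ := h
  exact ⟨B, r.comp h, K.isEmb_comp hh hr, hB, hBμ,
    NonSplit.restrict ht (hs.of_factor id fun b => hf _)⟩

/-- The two bases together have size below μ, and `M` is rich for that size. -/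
theorem nonsplittingOverSmall_unique (s : K.Setting μ) {M N : Bundled.{u} L.Structure}
    {f : M ↪[L] N} (hf : K.IsEmb f) (hM : #M = μ) (hN : #N = μ) {p q : K.GTp N} (hp : p ∈ K.S N)
    (hq : q ∈ K.S N) (hps : K.NonsplittingOverSmall μ f p) (hqs : K.NonsplittingOverSmall μ f q)
    (hpq : p.restrict f.toEmbedding = q.restrict f.toEmbedding) : p = q := by
  rw [s.nonsplittingOverSmall_iff hp] at hps
  rw [s.nonsplittingOverSmall_iff hq] at hqs
  obtain ⟨B, h, hh, hB, hBμ, hs⟩ := hps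
  obtain ⟨B', h', hh', hB', hBμ', hs'⟩ := hqs
  have hlt : #(B ⊕ B') < μ := by
    rw [mk_sum, lift_id, lift_id]
    exact add_lt_of_lt s.aleph0_le hBμ hBμ'
  exact s.unique hf hN.le (θ := #(B ⊕ B')) (hB.trans (mk_le_of_injective Sum.inl_injective))
    (s.rich hlt hM.ge) le_rfl hlt.le (h := Sum.elim h h') hp hq
    (hs.of_factor Sum.inl fun _ => rfl) (hs'.of_factor Sum.inr fun _ => rfl) hpq

theorem nonsplittingOverSmall_trans (s : K.Setting μ) {M₀ M₁ M₂ : Bundled.{u} L.Structure}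
    {f : M₀ ↪[L] M₁} {g : M₁ ↪[L] M₂} (hg : K.IsEmb g) (hM₁ : #M₁ = μ)
    {p : K.GTp M₂} (hp : p ∈ K.S M₂) (h₁ : K.NonsplittingOverSmall μ g p)
    (h₀ : K.NonsplittingOverSmall μ f (p.restrict g.toEmbedding)) :
    K.NonsplittingOverSmall μ (g.comp f) p := by
  rw [s.nonsplittingOverSmall_iff hp] at h₁ ⊢
  rw [s.nonsplittingOverSmall_iff (restrict_mem_S hg hp)] at h₀
  obtain ⟨B, h, hh, hB, hBμ, hs⟩ := h₁
  obtain ⟨B', h', hh', hB', hBμ', hs'⟩ := h₀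
  have hlt : #(B ⊕ B') < μ := by
    rw [mk_sum, lift_id, lift_id]
    exact add_lt_of_lt s.aleph0_le hBμ hBμ'
  exact ⟨B', h', hh', hB', hBμ', s.trans hg (θ := #(B ⊕ B'))
    (hB.trans (mk_le_of_injective Sum.inl_injective)) (s.rich hlt hM₁.ge)
    (mk_le_of_injective Sum.inr_injective) (mk_le_of_injective Sum.inl_injective) hlt.le hp hs hs'⟩

end Setting

/-! ### The frame -/

section Frame

variable {M : Bundled.{u} L.Structure}

/-- The nonforking relation given by nonsplitting over small submodels. -/
def NonForking (K : AbstractClass L) (M : Bundled.{u} L.Structure) (μ : Cardinal.{u})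
    {N₀ N₁ N : Bundled.{u} L[[M]].Structure} (f : N₀ ↪[L[[M]]] N₁) (g : N₁ ↪[L[[M]]] N) (a : N) :
    Prop :=
  ∃ (_ : ((K.above M).restrict {μ}).IsEmb f) (hg : ((K.above M).restrict {μ}).IsEmb g),
    a ∉ Set.range g ∧
      K.NonsplittingOverSmall μ (redEmb f) (K.tp (K.mem_cod hg.1.2.2) (redEmb g).toEmbedding a)

/-- The type-full frame of nonsplitting over small submodels. -/
def Setting.frame (s : K.Setting μ) (hM : K.Mem M) (hMμ : #M = μ) : (K.above M).PreFrame μ where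
  bs N := {p | ((K.above M).restrict {μ}).Mem N ∧ p ∈ (K.above M).Sna N}
  nf := K.NonForking M μ
  isAEC := isAEC_above s.isAEC M
  LS_le := csInf_le' (isLSNumber_above s.isAEC s.LS_lt.le hMμ.le)
  nonempty := ⟨expand (Embedding.refl L M), aboveMem_expand (isEmb_refl hM), hMμ⟩
  bs_sub h := h
  nf_dom := fun ⟨hf, hg, _⟩ => ⟨hf, hg⟩
  bs_invariance {N N'} e p := by
    rintro ⟨hN, hp, hna⟩
    have hN' := ((K.above M).restrict {μ}).mem_cod
      (((K.above M).restrict {μ}).isEmb_equiv e hN)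
    have hp' := restrict_mem_S ((K.above M).isEmb_equiv e.symm hN'.1) hp
    refine ⟨hN', hp', fun ha => hna ?_⟩
    obtain ⟨x, hx⟩ := (isAlgebraic_iff hp').1 ha
    exact (isAlgebraic_iff hp).2 ⟨_, (isEq_restrict _ _ _).1 hx⟩
  nf_invariance {N₀ N₁ N N₀' N₁' N' f g f' g' a} e₀ e₁ e hf' hg' := by
    rintro ⟨hf, hg, ha, hs⟩
    let R := (K.above M).restrict {μ}
    have he₀ := R.isEmb_equiv e₀ (R.mem_dom hf)
    have he₁ := R.isEmb_equiv e₁ (R.mem_dom hg)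
    have he := R.isEmb_equiv e (R.mem_cod hg)
    have he₀' := R.isEmb_equiv e₀.symm (R.mem_cod he₀)
    have he₁' := R.isEmb_equiv e₁.symm (R.mem_cod he₁)
    have hf₁ : R.IsEmb f' := by
      have := R.isEmb_comp (R.isEmb_comp he₀' hf) he₁
      convert this using 1
      ext x
      obtain ⟨y, rfl⟩ := e₀.surjective x
      rw [hf']
      exact congrArg (fun z => e₁ (f z)) (e₀.symm_apply_apply y).symm
    have hg₁ : R.IsEmb g' := by
      have := R.isEmb_comp (R.isEmb_comp he₁' hg) he
      convert this using 1
      ext x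
      obtain ⟨y, rfl⟩ := e₁.surjective x
      rw [hg']
      exact congrArg (fun z => e (g z)) (e₁.symm_apply_apply y).symm
    refine ⟨hf₁, hg₁, ?_, ?_⟩
    · rintro ⟨x, hx⟩
      obtain ⟨y, rfl⟩ := e₁.surjective x
      rw [hg'] at hx
      exact ha ⟨y, e.injective hx⟩
    · have hff' : ∀ x : N₀, e₁.symm (f' (e₀ x)) = f x := fun x => by
        rw [hf', e₁.symm_apply_apply]
      have hgg' : ∀ x : N₁', e (g (e₁.symm x)) = g' x := fun x => by
        obtain ⟨y, rfl⟩ := e₁.surjective x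
        rw [hg', e₁.symm_apply_apply]
      have h := s.nonsplittingOverSmall_restrict (f := redEmb f) (f' := redEmb f')
        (r := redEmb e₀.toEmbedding) (t := redEmb e₁.symm.toEmbedding) he₀.1.2.2 he₁'.1.2.2
        hff' (tp_mem_S hg.1.2.2 (K.mem_cod hg.1.2.2) a) hs
      have e' : (K.tp (K.mem_cod hg.1.2.2) (redEmb g).toEmbedding a).restrict
          (redEmb e₁.symm.toEmbedding).toEmbedding =
          K.tp (K.mem_cod hg₁.1.2.2) (redEmb g').toEmbedding (e a) :=
        tp_eq_tp_of_isEmb he.1.2.2 _ _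
          (i := (redEmb e₁.symm.toEmbedding).toEmbedding.trans (redEmb g).toEmbedding) hgg' rfl
      rwa [e'] at h
  monotonicity {M₀ M₀' M₁' M₁ N' N N''} r k t v w z a hr hk ht hv hw hz := by
    rintro ⟨hf, hg, ha, hs⟩
    let R := (K.above M).restrict {μ}
    have hva : a ∉ Set.range (v.comp t) := by
      rintro ⟨x, rfl⟩
      exact ha ⟨t x, rfl⟩
    have h := s.nonsplittingOverSmall_restrict (f := redEmb (t.comp (k.comp r)))
      (f' := redEmb k) (r := redEmb r) (t := redEmb t) hr.1.2.2 ht.1.2.2 (fun x => rfl)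
      (tp_mem_S hg.1.2.2 (K.mem_cod hg.1.2.2) (w a)) hs
    have e₁ : K.tp (K.mem_cod hv.1.2.2) (redEmb (v.comp t)).toEmbedding a =
        (K.tp (K.mem_cod hg.1.2.2) (redEmb (w.comp v)).toEmbedding (w a)).restrict
          (redEmb t).toEmbedding :=
      tp_eq_tp_of_isEmb hw.1.2.2 _ _
        (j := (redEmb t).toEmbedding.trans (redEmb (w.comp v)).toEmbedding) (fun _ => rfl) rfl
    have e₂ : (K.tp (K.mem_cod hg.1.2.2) (redEmb (w.comp v)).toEmbedding (w a)).restrict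
          (redEmb t).toEmbedding =
        K.tp (K.mem_cod hz.1.2.2) (redEmb (z.comp (w.comp (v.comp t)))).toEmbedding (z (w a)) :=
      tp_eq_tp_of_isEmb hz.1.2.2 _ _
        (i := (redEmb t).toEmbedding.trans (redEmb (w.comp v)).toEmbedding) (fun _ => rfl) rfl
    refine ⟨⟨hk, R.isEmb_comp ht hv, hva, e₁ ▸ h⟩, hk,
      R.isEmb_comp (R.isEmb_comp (R.isEmb_comp ht hv) hw) hz, ?_, e₂ ▸ h⟩
    rintro ⟨x, hx⟩
    exact hva ⟨x, w.injective (z.injective hx)⟩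
  nf_bs {N₁ N} f g hg a hf := by
    rintro ⟨hf', hg', ha, -⟩
    exact ⟨((K.above M).restrict {μ}).mem_dom hf', tp_mem_S hg _ a,
      fun h => ha ((isAlgebraic_tp_iff hg _ a).1 h)⟩

/-! ### The axioms of a good frame without symmetry -/

namespace Setting

/-- Nonforking depends only on the type, and a type over a model of size μ is realized in an
extension of size exactly μ. -/
theorem doesNotFork_iff (s : K.Setting μ) (hM : K.Mem M) (hMμ : #M = μ)
    {N₀ N₁ : Bundled.{u} L[[M]].Structure} {f : N₀ ↪[L[[M]]] N₁} {p : (K.above M).GTp N₁} :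
    (s.frame hM hMμ).DoesNotFork f p ↔ ((K.above M).restrict {μ}).IsEmb f ∧
      p ∈ (K.above M).Sna N₁ ∧ K.NonsplittingOverSmall μ (redEmb f) p.red := by
  constructor
  · rintro ⟨N, g, hg, a, rfl, hf, hg', ha, hs⟩
    exact ⟨hf, ⟨tp_mem_S hg _ a, fun h => ha ((isAlgebraic_tp_iff hg _ a).1 h)⟩, hs⟩
  · rintro ⟨hf, ⟨hp, hna⟩, hs⟩
    obtain ⟨q, ⟨N, g, hg, a, rfl⟩, rfl⟩ :=
      ((s.frame hM hMμ).isAEC.shrinks_singleton (s.frame hM hMμ).LS_le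
        hf.2.2).exists_ofRestrict_eq (s.frame hM hMμ).isAEC hf.2.2 hp
    exact ⟨N, g, hg.1, a, rfl, hf, hg, fun ha => hna ((isAlgebraic_tp_iff hg.1 _ a).2 ha), hs⟩

/-- `(K_M)_μ` has no maximal models if `M` is not maximal. -/
theorem noMaximalModels_above (s : K.Setting μ) (hM : K.Mem M) (hMμ : #M = μ)
    (hmax : ¬ K.IsMaximalModel M) : ((K.above M).restrict {μ}).NoMaximalModels := by
  rintro N ⟨⟨hN, hNμ⟩, hNmax⟩
  obtain ⟨c, hc, hcN⟩ := hN
  simp only [IsMaximalModel, not_and, not_forall] at hmax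
  obtain ⟨P, f, hf, hfs⟩ := hmax hM
  obtain ⟨a, ha⟩ := not_forall.1 hfs
  -- The type of a new element over `M` has a nonalgebraic extension to `N`; maximality would place
  -- a realization of it inside `N`.
  obtain ⟨q, hq, -, -, hqa⟩ := s.exists_nonSplit_extension hc hMμ hNμ
    (tp_mem_S hf (K.mem_cod hf) a)
  obtain ⟨q', ⟨Q, g, hg, b, rfl⟩, rfl⟩ := (s.isAEC.shrinks_singleton s.LS_lt.le
    hNμ).exists_ofRestrict_eq s.isAEC hNμ hq
  obtain ⟨d, g', hg', hgg', -⟩ := AboveMem.exists_lift ⟨c, hc, hcN⟩ hg.1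
  obtain ⟨x, hx⟩ := hNmax (expand d) g' ⟨hg', hg.2⟩ b
  obtain ⟨y, hy⟩ := hqa x (hx.symm.trans (congrArg (fun k => k x) hgg'))
  exact ha ⟨y, hy.symm⟩

theorem amalgamation_above (s : K.Setting μ) (M : Bundled.{u} L.Structure) :
    ((K.above M).restrict {μ}).Amalgamation := by
  intro M₀ M₁ M₂ f₁ f₂ h₁ h₂
  obtain ⟨M₃, g₁, g₂, hg₁, hg₂, hM₃, hg⟩ := s.amalgamation h₁.1.2.2 h₂.1.2.2 h₁.2.1 h₁.2.2 h₂.2.2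
  obtain ⟨c, g₁', hg₁', rfl, hc⟩ := AboveMem.exists_lift h₁.1.2.1 hg₁
  exact ⟨expand c, g₁', liftEmb (N' := expand c) g₂ (fun m => by
    refine Eq.trans ?_ (hc m).symm
    rw [← redEmb_constVal f₁, ← redEmb_constVal f₂]
    exact (hg _).symm), ⟨hg₁', h₁.2.2, hM₃⟩, ⟨⟨h₂.1.2.1, hg₁'.2.1, hg₂⟩, h₂.2.2, hM₃⟩, hg⟩

/-- Both models lie above `M`, so amalgamating over `M` embeds them jointly. -/
theorem jointEmbedding_above (s : K.Setting μ) (hMμ : #M = μ) :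
    ((K.above M).restrict {μ}).JointEmbedding := by
  rintro M₁ M₂ ⟨⟨c₁, hc₁, hcM₁⟩, hM₁⟩ ⟨⟨c₂, hc₂, hcM₂⟩, hM₂⟩
  obtain ⟨M₃, g₁, g₂, hg₁, hg₂, hM₃, hg⟩ := s.amalgamation hc₁ hc₂ hMμ hM₁ hM₂
  obtain ⟨c, g₁', hg₁', rfl, hc⟩ := AboveMem.exists_lift ⟨c₁, hc₁, hcM₁⟩ hg₁
  exact ⟨expand c, g₁', liftEmb (N' := expand c) g₂ (fun m => by
    refine Eq.trans ?_ (hc m).symm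
    rw [← hcM₁, ← hcM₂]
    exact (hg _).symm), ⟨hg₁', hM₁, hM₃⟩, ⟨⟨⟨c₂, hc₂, hcM₂⟩, hg₁'.2.1, hg₂⟩, hM₂, hM₃⟩⟩

theorem mk_Sna_above_le (s : K.Setting μ) {N : Bundled.{u} L[[M]].Structure}
    (hN : K.AboveMem M N) (hNμ : #N = μ) :
    #((K.above M).Sna N) ≤ Cardinal.lift.{u + 1} μ :=
  (mk_le_of_injective (f := fun p : (K.above M).Sna N => (⟨p.1.red, red_mem_S p.2.1⟩ : K.S (red N)))
    (fun p q h => Subtype.ext (red_injOn s.isAEC N p.2.1 q.2.1 (congrArg Subtype.val h)))).trans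
    (s.mk_S_le hN.mem_red hNμ)

theorem isEmb_of_isUnion (s : K.Setting μ) {I : Type u} [LinearOrder I] [Nonempty I]
    {D : ((K.above M).restrict {μ}).System I} {N : Bundled.{u} L[[M]].Structure}
    {g : ∀ i, D.obj i ↪[L[[M]]] N} (hg : D.IsUnion N g) (hN : ((K.above M).restrict {μ}).Mem N)
    (i : I) : ((K.above M).restrict {μ}).IsEmb (g i) := by
  let D' : (K.above M).System I :=
    { obj := D.obj
      map := D.map
      isEmb := fun h => (D.isEmb h).1
      map_refl := D.map_refl
      map_map := D.map_map }
  exact ⟨((isAEC_above s.isAEC M).union I D' N g hg).2 i, (D.isEmb (le_refl i)).2.1, hN.2⟩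

theorem exists_nonsplittingOverSmall_chain (s : K.Setting μ) {I : Type u} [LinearOrder I]
    [Nonempty I] {D : ((K.above M).restrict {μ}).System I} {N : Bundled.{u} L[[M]].Structure}
    {g : ∀ i, D.obj i ↪[L[[M]]] N} (hg : D.IsUnion N g) (hN : ((K.above M).restrict {μ}).Mem N)
    {p : K.GTp (red N)} (hp : p ∈ K.S (red N)) :
    ∃ i, K.NonsplittingOverSmall μ (redEmb (g i)) p := by
  let D' : K.System I :=
    { obj := fun i => red (D.obj i)
      map := fun h => redEmb (D.map h)
      isEmb := fun h => (D.isEmb h).1.2.2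
      map_refl := D.map_refl
      map_map := D.map_map }
  have hg' : D'.IsUnion (red N) (fun i => redEmb (g i)) := hg
  obtain ⟨i, h⟩ := s.chainLocalCharacter (D := D') (M := red N)
    (fun i => (D.isEmb (le_refl i)).2.1) hN.2 hg' (fun i => (s.isEmb_of_isUnion hg hN i).1.2.2) hp
  exact ⟨i, (s.nonsplittingOverSmall_iff hp).2 h⟩

theorem isGoodMinusS_frame (s : K.Setting μ) (hM : K.Mem M) (hMμ : #M = μ)
    (hmax : ¬ K.IsMaximalModel M) : (s.frame hM hMμ).IsGoodMinusS where
  amalgamation := s.amalgamation_above M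
  jointEmbedding := s.jointEmbedding_above hMμ
  noMaximalModels := s.noMaximalModels_above hM hMμ hmax
  stability N hN := (mk_le_mk_of_subset fun p hp => hp.2).trans (s.mk_Sna_above_le hN.1 hN.2)
  density {N N'} f hf hsurj := by
    obtain ⟨a, ha⟩ := not_forall.1 hsurj
    exact ⟨a, ((K.above M).restrict {μ}).mem_dom hf, tp_mem_S hf.1 _ a,
      fun h => ha ((isAlgebraic_tp_iff hf.1 _ a).1 h)⟩
  existence {N N'} f hf := by
    rintro p ⟨hN, hp⟩
    obtain ⟨q, hq, hqp, hB, hqa⟩ := s.exists_nonSplit_extension hf.1.2.2 hf.2.1 hf.2.2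
      (red_mem_S hp.1)
    obtain ⟨q, hq', rfl⟩ := hf.1.2.1.exists_red_eq hq
    have hna : q ∈ (K.above M).Sna N' := by
      refine ⟨hq', fun h => ?_⟩
      obtain ⟨x, hx⟩ := (isAlgebraic_iff hq').1 h
      obtain ⟨y, hy⟩ := hqa x ((isEq_red q x).2 hx)
      exact (red_mem_Sna hp).2 y hy
    refine ⟨q, ⟨((K.above M).restrict {μ}).mem_cod hf, hna⟩, ?_, ?_⟩
    · exact red_injOn s.isAEC N (restrict_mem_S hf.1 hq') hp.1
        ((red_restrict q f.toEmbedding).trans hqp)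
    · exact (s.doesNotFork_iff hM hMμ).2 ⟨hf, hna, (s.nonsplittingOverSmall_iff hq).2 hB⟩
  uniqueness {N N'} f hf p hp q hq hpf hqf hpq := by
    refine red_injOn s.isAEC N' hp.2.1 hq.2.1 (s.nonsplittingOverSmall_unique hf.1.2.2 hf.2.1
      hf.2.2 (red_mem_S hp.2.1) (red_mem_S hq.2.1) ((s.doesNotFork_iff hM hMμ).1 hpf).2.2
      ((s.doesNotFork_iff hM hMμ).1 hqf).2.2 ?_)
    have := congrArg GTp.red hpq
    rwa [red_restrict, red_restrict] at this
  localCharacter I _ _ _ _ D N g _ hg hN p hp := by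
    obtain ⟨i, hi⟩ := s.exists_nonsplittingOverSmall_chain hg hN (red_mem_S hp.2.1)
    exact ⟨i, (s.doesNotFork_iff hM hMμ).2 ⟨s.isEmb_of_isUnion hg hN i, hp.2, hi⟩⟩
  continuity I _ _ _ _ D N g _ hg hN i₀ h₀ p hp hpi := by
    -- By local character `p` does not split over a small submodel of some member `i`; its
    -- restriction to that member does not fork over `i₀`, and transitivity combines the two.
    obtain ⟨i, hi⟩ := s.exists_nonsplittingOverSmall_chain hg hN (red_mem_S hp)
    have hgE := s.isEmb_of_isUnion hg hN
    have hna : p ∈ (K.above M).Sna N := by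
      refine ⟨hp, fun h => ?_⟩
      obtain ⟨x, hx⟩ := (isAlgebraic_iff hp).1 h
      obtain ⟨j, y, rfl⟩ := hg.2 x
      exact (hpi j).1.2.2 ((isAlgebraic_iff (hpi j).1.2.1).2
        ⟨y, (isEq_restrict p (g j).toEmbedding y).2 hx⟩)
    refine ⟨⟨hN, hna⟩, (s.doesNotFork_iff hM hMμ).2 ⟨hgE i₀, hna, ?_⟩⟩
    have h := ((s.doesNotFork_iff hM hMμ).1 (hpi i).2).2.2
    rw [red_restrict] at h
    have h' := s.nonsplittingOverSmall_trans (g := redEmb (g i)) (hgE i).1.2.2 (hgE i).2.1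
      (red_mem_S hp) hi h
    have e : (redEmb (g i)).comp (redEmb (D.map (h₀ i))) = redEmb (g i₀) := by
      ext x
      exact hg.1 _ _ (h₀ i) x
    rwa [e] at h'
  transitivity {M₀ M₁ M₂} f g hf hg p hp hpg hpf := by
    have hpg := (s.doesNotFork_iff hM hMμ).1 hpg
    have h := ((s.doesNotFork_iff hM hMμ).1 hpf).2.2
    rw [red_restrict] at h
    exact (s.doesNotFork_iff hM hMμ).2 ⟨((K.above M).restrict {μ}).isEmb_comp hf hg, hpg.2.1,
      s.nonsplittingOverSmall_trans (f := redEmb f) (g := redEmb g) hg.1.2.2 hg.2.1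
        (red_mem_S hp) hpg.2.2 h⟩

end Setting

end Frame

end AbstractClass

theorem mainTheorem8 {L : FirstOrder.Language.{u, u}} (K : AbstractClass L) (hK : K.IsAEC)
    (μ : Cardinal.{u}) (hμLS : K.LS < μ) (hμ : μ.IsStrongLimit)
    (hcof : μ.ord.cof = Cardinal.aleph0)
    (hwap : (K.restrict {μ}).WeakAmalgamation)
    (hcoh : (K.restrict (Set.Iio μ)).HasCoherentSequences)
    (htame : (K.restrict (Set.Iic μ)).Tame K.LS)
    (hcat : ∀ θ : Cardinal.{u}, Cardinal.aleph0 ≤ θ → θ < μ →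
      ∃ κ : Cardinal.{u}, Cardinal.aleph0 ≤ κ ∧ κ < μ ∧ κ = κ ^ θ ∧
        (K.restrict {κ}).Categorical)
    (M : Bundled.{u} L.Structure) (hM : (K.restrict {μ}).Mem M) (hMmax : ¬ K.IsMaximalModel M) :
    ∃ s : (K.above M).PreFrame μ, s.IsTypeFull ∧ s.IsGoodMinusS ∧
      ∀ {N₀ N₁ N : Bundled.{u} L[[M]].Structure} (f : N₀ ↪[L[[M]]] N₁) (g : N₁ ↪[L[[M]]] N)
        (hf : ((K.above M).restrict {μ}).IsEmb f) (hg : ((K.above M).restrict {μ}).IsEmb g)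
        (a : N),
        s.nf f g a ↔ a ∉ Set.range g ∧
          K.NonsplittingOverSmall μ (AbstractClass.redEmb f)
            (K.tp (K.mem_cod hg.1.2.2) (AbstractClass.redEmb g).toEmbedding a) := by
  have s : K.Setting μ := ⟨hK, hμLS, hcof, hwap, hcoh, htame, hcat⟩
  exact ⟨s.frame hM.1 hM.2, fun N hN => Set.ext fun p => and_iff_right hN,
    s.isGoodMinusS_frame hM.1 hM.2 hMmax, fun f g hf hg a =>
      ⟨fun ⟨_, _, h⟩ => h, fun h => ⟨hf, hg, h⟩⟩⟩
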